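/- **Theorem 2.9 (large deviations).** Let $f:\widehat{\mathbb C}\to\widehat{\mathbb C}$ be a rational map of degree $d\ge 2$ which is hyperbolic, i.e. the orbit of every critical point converges to an attracting periodic orbit. Assume that its Julia set $J$ does not contain $\infty$, so that $J\subset\mathbb C$ is compact. Let $U\subset\mathbb C$ be an open neighbourhood of $J$. For $\varphi\in C^1(U,\mathbb R)$ let $$P(\varphi)=\sup_{\mu}\Big(h_f(\mu)+\int_J\varphi\,d\mu\Big),$$ where $\mu$ runs over the $f$-invariant Borel probability measures on $J$ and $h_f(\mu)$ is the measure-theoretic entropy; an equilibrium measure $\mu_\varphi$ of $\varphi$ is an $f$-invariant Borel probability measure on $J$ at which the supremum is attained. The transfer operator is $\mathcal L_\varphi h(x)=\sum_{f(y)=x}e^{\varphi(y)}h(y)$. The potential $\varphi$, with equilibrium measure $\mu_\varphi$, is called normalized if $P(\varphi)=0$, $\varphi<0$ on $J$, $\mathcal L_\varphi 1=1$ on $J$, and $\mathcal L_\varphi^*\mu_\varphi=\mu_\varphi$, i.e. $\int_J\mathcal L_\varphi h\,d\mu_\varphi=\int_J h\,d\mu_\varphi$ for every continuous $h:J\to\mathbb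 C$. Let $\varphi\in C^1(U,\mathbb R)$ be normalized with equilibrium measure $\mu_\varphi$, and let $\psi\in C^1(U,\mathbb R)$. Write $S_n\psi=\sum_{k=0}^{n-1}\psi\circ f^k$ on $J$. Then for every $\varepsilon>0$ there exist $C,\delta_0>0$ such that $$\forall n\ge 1,\qquad \mu_\varphi\left(\left\{x\in J:\ \left|\frac1n S_n\psi(x)-\int_J\psi\,d\mu_\varphi\right|>\varepsilon\right\}\right)\le C e^{-\delta_0 n}.$$ -/

import Mathlib

open MeasureTheory Filter Topology
open scoped ENNReal OnePoint

/-! The Riemann sphere is `OnePoint ℂ`. -/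

namespace HypJulia

noncomputable section

/-- The point `[a : b]` of the Riemann sphere, i.e. `a / b`, read as `∞` when `b = 0`. -/
def ratio (a b : ℂ) : OnePoint ℂ := if b = 0 then ∞ else ((a / b : ℂ) : OnePoint ℂ)

/-- The self-map `p / q` of the Riemann sphere (for coprime `p`, `q`). At `∞` one compares the
coefficients of degree `max (deg p) (deg q)`. -/
def ratEval (p q : Polynomial ℂ) (x : OnePoint ℂ) : OnePoint ℂ :=
  x.elim (ratio (p.coeff (max p.natDegree q.natDegree)) (q.coeff (max p.natDegree q.natDegree)))
    (fun z => ratio (p.eval z) (q.eval z))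

/-- `f` is a rational map of degree `d` of the Riemann sphere: `f = p / q` with `p`, `q` coprime
and `d = max (deg p) (deg q)`. -/
def IsRationalMap (f : OnePoint ℂ → OnePoint ℂ) (d : ℕ) : Prop :=
  ∃ p q : Polynomial ℂ, IsCoprime p q ∧ max p.natDegree q.natDegree = d ∧ f = ratEval p q

/-- The iterates of `f` form a normal family on `U`: every sequence of iterates has a subsequence
converging locally uniformly on `U`, for the unique uniformity of the compact Hausdorff
space `OnePoint ℂ`. -/
def IterNormalOn (f : OnePoint ℂ → OnePoint ℂ) (U : Set (OnePoint ℂ)) : Prop :=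
  letI : UniformSpace (OnePoint ℂ) := uniformSpaceOfCompactR1
  ∀ s : ℕ → ℕ, ∃ k : ℕ → ℕ, StrictMono k ∧ ∃ g : OnePoint ℂ → OnePoint ℂ,
    TendstoLocallyUniformlyOn (fun n => f^[s (k n)]) g atTop U

/-- The Fatou set: the largest open set on which the iterates form a normal family. -/
def fatouSet (f : OnePoint ℂ → OnePoint ℂ) : Set (OnePoint ℂ) :=
  ⋃₀ {U | IsOpen U ∧ IterNormalOn f U}

/-- The Julia set. -/
def juliaSet (f : OnePoint ℂ → OnePoint ℂ) : Set (OnePoint ℂ) := (fatouSet f)ᶜ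

/-- The Julia set seen as a subset of the plane (used when it does not contain `∞`). -/
def planeJulia (f : OnePoint ℂ → OnePoint ℂ) : Set ℂ := {z | (z : OnePoint ℂ) ∈ juliaSet f}

/-- The affine coordinate of a point of the sphere (with the irrelevant value `0` at `∞`). -/
def toPlane (x : OnePoint ℂ) : ℂ := x.elim 0 id

/-- The map `f` read in the affine coordinate; it is used only on the Julia set, which is
invariant and contained in the plane, so that the value at the poles of `f` is irrelevant. -/
def planeMap (f : OnePoint ℂ → OnePoint ℂ) (z : ℂ) : ℂ := toPlane (f z)

/-- The inversion `z ↦ 1 / z` of the sphere. -/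
def sphereInv (x : OnePoint ℂ) : OnePoint ℂ := x.elim ((0 : ℂ) : OnePoint ℂ) (fun z => ratio 1 z)

/-- The derivative of `F` at a fixed point `x`, computed in the coordinate `z` when `x ≠ ∞`, and
in the coordinate `1 / z` when `x = ∞`. -/
def multiplier (F : OnePoint ℂ → OnePoint ℂ) (x : OnePoint ℂ) : ℂ :=
  x.elim (deriv (planeMap (fun y => sphereInv (F (sphereInv y)))) 0)
    (fun z => deriv (planeMap F) z)

/-- `x` lies on an attracting (possibly superattracting) periodic orbit of `f`. -/
def IsAttractingPeriodicPt (f : OnePoint ℂ → OnePoint ℂ) (x : OnePoint ℂ) : Prop :=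
  ∃ m : ℕ, 0 < m ∧ f^[m] x = x ∧ ‖multiplier f^[m] x‖ < 1

/-- `c` is a critical point of `f`: `f` is not injective on any neighbourhood of `c`. For a
nonconstant holomorphic map this means that the derivative (in charts) vanishes at `c`. -/
def IsCriticalPt (f : OnePoint ℂ → OnePoint ℂ) (c : OnePoint ℂ) : Prop :=
  ∀ W ∈ 𝓝 c, ¬ Set.InjOn f W

/-- Hyperbolicity: the orbit of every critical point converges to an attracting periodic orbit. -/
def IsHyperbolic (f : OnePoint ℂ → OnePoint ℂ) : Prop :=
  ∀ c, IsCriticalPt f c → ∃ x, IsAttractingPeriodicPt f x ∧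
    Tendsto (fun n : ℕ => f^[n] c) atTop (𝓝ˢ (Set.range fun k : ℕ => f^[k] x))

section Entropy

variable {X : Type*} [MeasurableSpace X]

/-- The Shannon entropy `-∑ μ(A_i) log μ(A_i)` of the finite partition into the fibres of `ξ`. -/
def partitionEntropy (μ : Measure X) {ι : Type*} [Fintype ι] (ξ : X → ι) : ℝ :=
  ∑ i, Real.negMulLog (μ.real (ξ ⁻¹' {i}))

/-- The fibres of `itinerary T ξ n` form the partition `ξ ∨ T⁻¹ ξ ∨ ⋯ ∨ T^{-(n-1)} ξ`. -/
def itinerary (T : X → X) {ι : Type*} (ξ : X → ι) (n : ℕ) (x : X) : Fin n → ι :=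
  fun j => ξ (T^[j] x)

/-- The entropy of `T` relative to a finite partition, the limit of
`H(ξ ∨ ⋯ ∨ T^{-(n-1)} ξ) / n` (the limit exists by subadditivity when `μ` is invariant). -/
def entropyRel (μ : Measure X) (T : X → X) {ι : Type*} [Fintype ι] (ξ : X → ι) : ℝ≥0∞ :=
  limsup (fun n : ℕ => ENNReal.ofReal (partitionEntropy μ (itinerary T ξ n) / n)) atTop

/-- The Kolmogorov-Sinai entropy: the supremum over the finite measurable partitions. -/
def ksEntropy (μ : Measure X) (T : X → X) : ℝ≥0∞ :=
  ⨆ (k : ℕ) (ξ : X → Fin k) (_ : Measurable ξ), entropyRel μ T ξ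

end Entropy

/-- The `f`-invariant Borel probability measures on the Julia set, as measures on `ℂ` carried by
the Julia set. -/
def invariantMeasures (f : OnePoint ℂ → OnePoint ℂ) : Set (Measure ℂ) :=
  {μ | IsProbabilityMeasure μ ∧ μ (planeJulia f)ᶜ = 0 ∧ MeasurePreserving (planeMap f) μ μ}

/-- `h_f(μ) + ∫ φ dμ`. -/
def freeEnergy (f : OnePoint ℂ → OnePoint ℂ) (φ : ℂ → ℝ) (μ : Measure ℂ) : EReal :=
  (ksEntropy μ (planeMap f) : EReal) + ((∫ x, φ x ∂μ : ℝ) : EReal)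

/-- The pressure `P(φ)`. -/
def pressure (f : OnePoint ℂ → OnePoint ℂ) (φ : ℂ → ℝ) : EReal :=
  ⨆ μ ∈ invariantMeasures f, freeEnergy f φ μ

/-- `μ` is an equilibrium state (equilibrium measure) of `φ`. -/
def IsEquilibriumState (f : OnePoint ℂ → OnePoint ℂ) (φ : ℂ → ℝ) (μ : Measure ℂ) : Prop :=
  μ ∈ invariantMeasures f ∧ freeEnergy f φ μ = pressure f φ

/-- The transfer operator `(L_φ h)(x) = ∑_{f(y) = x} exp(φ(y)) h(y)`, used for `x` in the Julia
set (all preimages then lie in the Julia set). -/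
def transfer (f : OnePoint ℂ → OnePoint ℂ) (φ : ℂ → ℝ) (h : ℂ → ℂ) (x : ℂ) : ℂ :=
  ∑ᶠ y ∈ {y : ℂ | f (y : OnePoint ℂ) = (x : OnePoint ℂ)}, (Real.exp (φ y) : ℂ) * h y

/-- The potential `φ`, with equilibrium state `μ`, is normalized: `P(φ) = 0`, `φ < 0` on `J`,
`L_φ 1 = 1` (required on `J` only) and `L_φ^* μ = μ`. -/
structure IsNormalized (f : OnePoint ℂ → OnePoint ℂ) (φ : ℂ → ℝ) (μ : Measure ℂ) : Prop where
  pressure_eq : pressure f φ = 0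
  neg : ∀ x ∈ planeJulia f, φ x < 0
  transfer_one : ∀ x ∈ planeJulia f, transfer f φ (fun _ => 1) x = 1
  dual_eq : ∀ h : ℂ → ℂ, ContinuousOn h (planeJulia f) →
    ∫ x, transfer f φ h x ∂μ = ∫ x, h x ∂μ

end

end HypJulia

/-!
The proof separates dynamics from probability.

*Dynamics.* Preimages of forward invariant neighbourhoods of the attracting cycles make up a trap
`A`: a set mapped into itself, at a positive distance from `J`, and containing a neighbourhood of
every critical point (`IsHyperbolic.exists_isTrap`). Over the complement of `A` every iterate of `f`
is a covering (`isCoveringMapOn_iterate`), so its inverse branches exist on discs of a fixed radius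
about the points of `J` (`exists_branch`), and these branches omit `A`.
If their derivatives did not tend uniformly to `0`, then images of branches of arbitrarily high
order would contain a fixed disc about a point of `J`; the iterates of `f` would omit an open set
on that disc, so the centre would lie in the Fatou set by Montel's theorem
(`mem_fatouSet_of_omits`). Hence the branches contract uniformly
(`IsTrap.exists_contraction`). The same normality argument shows that a nonempty closed subset of
`J` which contains its preimages is all of `J` (`IsTrap.planeJulia_subset`). Together these say
that `f` is an expanding system on `J` (`isExpandingSystem_julia`).

*Transfer operator.* Contraction of the branches gives a Lasota-Yorke inequality, so the functions
`Lⁿψ` are uniformly bounded and uniformly Lipschitz. By the maximum principle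
a continuous function fixed by the normalized operator attains its maximum on a backward invariant
closed set, hence is constant. By the Arzelà-Ascoli theorem the Cesàro averages of `Lⁿψ` therefore
converge uniformly to `∫ ψ dμ` (`exists_cesaro_close`).

*Concentration.* If an average `(1/N) ∑ Lᵏψ` is uniformly close to `∫ ψ dμ`, then up to a uniformly
small error `ψ - ∫ ψ dμ` is a coboundary plus a function `g` with `L g = 0`, that is, a bounded
reverse martingale difference. Since `L` is dual to composition with `f`, the exponential moments
of the Birkhoff sums of `g` grow at most as for independent centred variables, and Chernoff's bound
concludes (`exists_measureReal_birkhoffSum_le`). In particular neither a spectral gap nor the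
variational principle is needed.
-/

namespace HypJulia

/-! ### Concentration for normalized transfer operators -/

section Concentration

variable {X : Type*} [TopologicalSpace X]

/-- The abstract form of a normalized transfer operator for `T`: a positive, unital linear
operator on `C(X, ℝ)` satisfying the pull-out identity `L (g · h ∘ T) = L g · h`. -/
structure IsNormalizedTransfer (T : C(X, X)) (L : C(X, ℝ) →ₗ[ℝ] C(X, ℝ)) : Prop where
  nonneg : ∀ h : C(X, ℝ), (∀ x, 0 ≤ h x) → ∀ x, 0 ≤ L h x
  map_one : L 1 = 1
  pull_out : ∀ g h : C(X, ℝ), L (g * h.comp T) = L g * h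

namespace IsNormalizedTransfer

variable {T : C(X, X)} {L : C(X, ℝ) →ₗ[ℝ] C(X, ℝ)}

theorem mono (hL : IsNormalizedTransfer T L) {g h : C(X, ℝ)} (hgh : ∀ x, g x ≤ h x) (x : X) :
    L g x ≤ L h x := by
  have := hL.nonneg (h - g) (fun x => by simpa using hgh x) x
  simpa using this

theorem map_const (hL : IsNormalizedTransfer T L) (c : ℝ) :
    L (ContinuousMap.const X c) = ContinuousMap.const X c := by
  have : ContinuousMap.const X c = c • (1 : C(X, ℝ)) := by ext; simp
  rw [this, map_smul, hL.map_one]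

theorem abs_le (hL : IsNormalizedTransfer T L) {h : C(X, ℝ)} {B : ℝ} (hB : ∀ x, |h x| ≤ B)
    (x : X) : |L h x| ≤ B := by
  have h1 := hL.mono (g := h) (h := ContinuousMap.const X B) (fun y => (_root_.abs_le.1 (hB y)).2) x
  have h2 := hL.mono (g := ContinuousMap.const X (-B)) (h := h)
    (fun y => (_root_.abs_le.1 (hB y)).1) x
  rw [hL.map_const] at h1 h2
  exact _root_.abs_le.2 ⟨h2, h1⟩

theorem abs_pow_le (hL : IsNormalizedTransfer T L) {h : C(X, ℝ)} {B : ℝ} (hB : ∀ x, |h x| ≤ B)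
    (k : ℕ) (x : X) : |(L ^ k) h x| ≤ B := by
  induction k generalizing x with
  | zero => simpa using hB x
  | succ k ih => rw [pow_succ', Module.End.mul_apply]; exact hL.abs_le ih x

/-- If `L m = 0` then `L (exp (l m)) ≤ 1 + (l b)²` as soon as `|m| ≤ b` and `l b ≤ 1`: the linear
term of the exponential is killed. -/
theorem map_exp_le (hL : IsNormalizedTransfer T L) {m e : C(X, ℝ)} (hm : L m = 0) {b l : ℝ}
    (hb : ∀ x, |m x| ≤ b) (hl : 0 ≤ l) (hlb : l * b ≤ 1) (he : ∀ x, e x = Real.exp (l * m x))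
    (x : X) : L e x ≤ 1 + (l * b) ^ 2 := by
  have key : ∀ y, e y ≤ (ContinuousMap.const X (1 + (l * b) ^ 2) + l • m : C(X, ℝ)) y := by
    intro y
    have h1 : |l * m y| ≤ l * b := by
      rw [abs_mul, abs_of_nonneg hl]; exact mul_le_mul_of_nonneg_left (hb y) hl
    have h2 := (_root_.abs_le.1 (Real.abs_exp_sub_one_sub_id_le (h1.trans hlb))).2
    have h3 : (l * m y) ^ 2 ≤ (l * b) ^ 2 := sq_le_sq' (by linarith [(_root_.abs_le.1 h1).1])
      (_root_.abs_le.1 h1).2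
    simp only [ContinuousMap.add_apply, ContinuousMap.const_apply, ContinuousMap.smul_apply,
      smul_eq_mul, he]
    linarith
  have := hL.mono key x
  rw [map_add, map_smul, hm, hL.map_const] at this
  simpa using this

end IsNormalizedTransfer

theorem continuous_birkhoffSum (T : C(X, X)) (m : C(X, ℝ)) (n : ℕ) :
    Continuous (birkhoffSum T m n) := by
  unfold birkhoffSum
  exact continuous_finsetSum _ fun k _ => m.continuous.comp (T.continuous.iterate k)

variable [CompactSpace X] [MeasurableSpace X] [BorelSpace X] {T : C(X, X)}
  {L : C(X, ℝ) →ₗ[ℝ] C(X, ℝ)}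

theorem _root_.ContinuousMap.integrable_of_compactSpace (μ : Measure X) [IsFiniteMeasure μ]
    (h : C(X, ℝ)) : Integrable h μ := by
  obtain ⟨B, hB⟩ := isCompact_univ.exists_bound_of_continuousOn (f := h) h.continuous.continuousOn
  exact Integrable.of_bound h.continuous.aestronglyMeasurable B (ae_of_all _ fun x => hB x trivial)

/-- Exponential moments of Birkhoff sums of a reverse martingale difference `m` (that is,
`L m = 0`) for a measure fixed by the dual of `L`. -/
theorem integral_exp_birkhoffSum_le (hL : IsNormalizedTransfer T L) (μ : Measure X)
    [IsProbabilityMeasure μ] (hμ : ∀ h : C(X, ℝ), ∫ x, L h x ∂μ = ∫ x, h x ∂μ)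
    {m : C(X, ℝ)} (hm : L m = 0) {b l : ℝ} (hb : ∀ x, |m x| ≤ b) (hl : 0 ≤ l) (hlb : l * b ≤ 1)
    (n : ℕ) : ∫ x, Real.exp (l * birkhoffSum T m n x) ∂μ ≤ (1 + (l * b) ^ 2) ^ n := by
  induction n with
  | zero => simp
  | succ n ih =>
    let e : C(X, ℝ) := ⟨fun x => Real.exp (l * m x), by fun_prop⟩
    let F : C(X, ℝ) := ⟨fun x => Real.exp (l * birkhoffSum T m n x),
      Real.continuous_exp.comp (continuous_const.mul (continuous_birkhoffSum T m n))⟩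
    have h1 : ∀ x, Real.exp (l * birkhoffSum T m (n + 1) x) = (e * F.comp T) x := by
      intro x
      simp only [ContinuousMap.mul_apply, ContinuousMap.comp_apply, e, F, ContinuousMap.coe_mk]
      rw [birkhoffSum_succ', mul_add, Real.exp_add]
    have h2 : ∫ x, Real.exp (l * birkhoffSum T m (n + 1) x) ∂μ = ∫ x, (L e * F) x ∂μ := by
      simp_rw [h1]
      rw [← hL.pull_out, hμ]
    rw [h2, pow_succ']
    calc ∫ x, (L e * F) x ∂μ ≤ ∫ x, (1 + (l * b) ^ 2) * F x ∂μ := by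
          refine integral_mono (ContinuousMap.integrable_of_compactSpace μ _)
            ((ContinuousMap.integrable_of_compactSpace μ F).const_mul _) fun x => ?_
          exact mul_le_mul_of_nonneg_right (hL.map_exp_le hm hb hl hlb (fun _ => rfl) x)
            (Real.exp_pos _).le
      _ = (1 + (l * b) ^ 2) * ∫ x, F x ∂μ := integral_const_mul _ _
      _ ≤ _ := mul_le_mul_of_nonneg_left ih (by positivity)

/-- Chernoff bound for the Birkhoff sums of a reverse martingale difference. -/
theorem measureReal_birkhoffSum_gt_le (hL : IsNormalizedTransfer T L) (μ : Measure X)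
    [IsProbabilityMeasure μ] (hμ : ∀ h : C(X, ℝ), ∫ x, L h x ∂μ = ∫ x, h x ∂μ)
    {m : C(X, ℝ)} (hm : L m = 0) {b l : ℝ} (hb : ∀ x, |m x| ≤ b) (hl : 0 ≤ l) (hlb : l * b ≤ 1)
    (n : ℕ) (t : ℝ) :
    μ.real {x | t ≤ birkhoffSum T m n x} ≤ Real.exp (n * (l * b) ^ 2 - l * t) := by
  have hint : Integrable (fun x => Real.exp (l * birkhoffSum T m n x)) μ :=
    ContinuousMap.integrable_of_compactSpace μ ⟨_,
      Real.continuous_exp.comp (continuous_const.mul (continuous_birkhoffSum T m n))⟩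
  have h1 := ProbabilityTheory.measure_ge_le_exp_mul_mgf (X := birkhoffSum T m n) (μ := μ) t hl hint
  refine h1.trans ?_
  have h2 := integral_exp_birkhoffSum_le hL μ hμ hm hb hl hlb n
  have h3 : (1 + (l * b) ^ 2) ^ n ≤ Real.exp (n * (l * b) ^ 2) := by
    rw [Real.exp_nat_mul]
    exact pow_le_pow_left₀ (by positivity) (by linarith [Real.add_one_le_exp ((l * b) ^ 2)]) n
  calc _ ≤ Real.exp (-l * t) * Real.exp (n * (l * b) ^ 2) :=
        mul_le_mul_of_nonneg_left (h2.trans h3) (Real.exp_pos _).le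
    _ = _ := by rw [← Real.exp_add]; ring_nf

/-- A function differs from each of its Cesàro averages under a linear operator by an element of
the range of `1 - L`. -/
theorem exists_sub_cesaro_eq {V : Type*} [AddCommGroup V] [Module ℝ V] (L : V →ₗ[ℝ] V) (ψ : V)
    {n : ℕ} (hn : 0 < n) :
    ∃ g : V, ψ - (n : ℝ)⁻¹ • ∑ k ∈ Finset.range n, (L ^ k) ψ = g - L g := by
  refine ⟨(n : ℝ)⁻¹ • ∑ k ∈ Finset.range n, ∑ j ∈ Finset.range k, (L ^ j) ψ, ?_⟩
  have h1 : ∀ k, (∑ j ∈ Finset.range k, (L ^ j) ψ) - L (∑ j ∈ Finset.range k, (L ^ j) ψ)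
      = ψ - (L ^ k) ψ := by
    intro k
    rw [map_sum, ← Finset.sum_sub_distrib]
    have := Finset.sum_range_sub' (fun j => (L ^ j) ψ) k
    simp only [pow_zero, Module.End.one_apply] at this
    rw [← this]
    refine Finset.sum_congr rfl fun j _ => ?_
    rw [pow_succ', Module.End.mul_apply]
  rw [map_smul, ← smul_sub, map_sum, ← Finset.sum_sub_distrib, Finset.sum_congr rfl fun k _ => h1 k,
    Finset.sum_sub_distrib, smul_sub]
  congr 1
  simp only [Finset.sum_const, Finset.card_range]
  rw [← Nat.cast_smul_eq_nsmul ℝ, smul_smul, inv_mul_cancel₀ (by positivity), one_smul]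

/-- Exponential concentration of Birkhoff sums, given that the Cesàro averages of `Lᵏ ψ` come
uniformly close to a constant. -/
theorem exists_measureReal_birkhoffSum_le (hL : IsNormalizedTransfer T L) (μ : Measure X)
    [IsProbabilityMeasure μ] (hμ : ∀ h : C(X, ℝ), ∫ x, L h x ∂μ = ∫ x, h x ∂μ)
    (ψ : C(X, ℝ)) (c : ℝ)
    (hces : ∀ η > 0, ∃ n : ℕ, 0 < n ∧
      ∀ x, |((n : ℝ)⁻¹ • ∑ k ∈ Finset.range n, (L ^ k) ψ) x - c| ≤ η)
    {ε : ℝ} (hε : 0 < ε) :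
    ∃ C δ : ℝ, 0 < C ∧ 0 < δ ∧ ∀ n : ℕ, 1 ≤ n →
      μ.real {x | |birkhoffSum T ψ n x / n - c| > ε} ≤ C * Real.exp (-(n * δ)) := by
  obtain ⟨N, hN, hces⟩ := hces (ε / 2) (by positivity)
  obtain ⟨g, hg⟩ := exists_sub_cesaro_eq L ψ hN
  set A := (N : ℝ)⁻¹ • ∑ k ∈ Finset.range N, (L ^ k) ψ with hA
  -- `ψ - A = (g - (L g) ∘ T) + ((L g) ∘ T - L g)`: a martingale difference and a coboundary.
  set v := L g with hv
  set m := g - v.comp T with hm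
  have hLm : L m = 0 := by
    have := hL.pull_out 1 v
    rw [one_mul, hL.map_one, one_mul] at this
    rw [hm, map_sub, this, ← hv, sub_self]
  have hLnm : L (-m) = 0 := by rw [map_neg, hLm, neg_zero]
  obtain ⟨b₀, hb₀⟩ := isCompact_univ.exists_bound_of_continuousOn (f := m) m.continuous.continuousOn
  obtain ⟨B₀, hB₀⟩ := isCompact_univ.exists_bound_of_continuousOn (f := v) v.continuous.continuousOn
  set b := max b₀ 1
  set B := max B₀ 0
  have hbpos : 1 ≤ b := le_max_right _ _
  have hb : ∀ x, |m x| ≤ b := fun x => (hb₀ x trivial).trans (le_max_left _ _)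
  have hB : ∀ x, |v x| ≤ B := fun x => (hB₀ x trivial).trans (le_max_left _ _)
  have hBpos : 0 ≤ B := le_max_right _ _
  -- This `l` makes `l b ≤ 1` and `(l b)² ≤ l ε / 4`.
  set l := min (1 / b) (ε / (4 * b ^ 2)) with hl
  have hlpos : 0 < l := lt_min (by positivity) (by positivity)
  have hlb : l * b ≤ 1 := by
    have := min_le_left (1 / b) (ε / (4 * b ^ 2))
    rw [← hl, le_div_iff₀ (by positivity)] at this
    exact this
  have hlb2 : (l * b) ^ 2 ≤ l * ε / 4 := by
    have := min_le_right (1 / b) (ε / (4 * b ^ 2))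
    rw [← hl, le_div_iff₀ (by positivity)] at this
    nlinarith
  refine ⟨2 * Real.exp (l * (2 * B)), l * ε / 4, by positivity, by positivity, fun n hn => ?_⟩
  have hn0 : (0 : ℝ) < n := by exact_mod_cast hn
  have hsum : ∀ x, |birkhoffSum T ψ n x - n * c - birkhoffSum T m n x| ≤ n * (ε / 2) + 2 * B := by
    intro x
    have h1 : birkhoffSum T ψ n x - n * c - birkhoffSum T m n x =
        (∑ k ∈ Finset.range n, (A (T^[k] x) - c)) + (v (T^[n] x) - v x) := by
      have h2 : v (T^[n] x) - v x = ∑ k ∈ Finset.range n, (v (T^[k + 1] x) - v (T^[k] x)) := by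
        rw [Finset.sum_range_sub (fun k => v (T^[k] x))]; simp
      rw [h2]
      unfold birkhoffSum
      have h3 : (n : ℝ) * c = ∑ k ∈ Finset.range n, c := by simp
      rw [h3, ← Finset.sum_sub_distrib, ← Finset.sum_sub_distrib, ← Finset.sum_add_distrib]
      refine Finset.sum_congr rfl fun k _ => ?_
      have h4 := DFunLike.congr_fun hg (T^[k] x)
      simp only [ContinuousMap.sub_apply] at h4
      simp only [hm, ContinuousMap.sub_apply, ContinuousMap.comp_apply]
      rw [Function.iterate_succ_apply']
      linarith
    rw [h1]
    have h5 : |∑ k ∈ Finset.range n, (A (T^[k] x) - c)| ≤ n * (ε / 2) := by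
      refine (Finset.abs_sum_le_sum_abs _ _).trans ((Finset.sum_le_sum fun k _ => hces _).trans ?_)
      simp
    have h6 := abs_sub (v (T^[n] x)) (v x)
    have h7 := abs_add_le (∑ k ∈ Finset.range n, (A (T^[k] x) - c)) (v (T^[n] x) - v x)
    linarith [hB (T^[n] x), hB x]
  set t := n * (ε / 2) - 2 * B with ht
  have hsub : {x | |birkhoffSum T ψ n x / n - c| > ε} ⊆
      {x | t ≤ birkhoffSum T m n x} ∪ {x | t ≤ birkhoffSum T (-m) n x} := by
    intro x hx
    have hx' : n * ε < |birkhoffSum T ψ n x - n * c| := by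
      have h1 : birkhoffSum T ψ n x - n * c = n * (birkhoffSum T ψ n x / n - c) := by field_simp
      rw [h1, abs_mul, abs_of_pos hn0]
      exact mul_lt_mul_of_pos_left hx hn0
    have h2 := hsum x
    have h3 : birkhoffSum T (-m) n x = - birkhoffSum T m n x := by simp [birkhoffSum]
    have h4 : t ≤ |birkhoffSum T m n x| := by
      have := abs_sub_abs_le_abs_sub (birkhoffSum T ψ n x - n * c) (birkhoffSum T m n x)
      rw [ht]; linarith
    simp only [Set.mem_union, Set.mem_ofPred_eq, h3]
    exact le_abs.1 h4
  have hexp : Real.exp (n * (l * b) ^ 2 - l * t) ≤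
      Real.exp (l * (2 * B)) * Real.exp (-(n * (l * ε / 4))) := by
    rw [← Real.exp_add]
    apply Real.exp_le_exp.2
    have := mul_le_mul_of_nonneg_left hlb2 hn0.le
    rw [ht]
    linarith
  have e1 := measureReal_birkhoffSum_gt_le hL μ hμ hLm hb hlpos.le hlb n t
  have e2 := measureReal_birkhoffSum_gt_le hL μ hμ hLnm (b := b) (by simpa using hb) hlpos.le hlb
    n t
  calc _ ≤ _ := measureReal_mono hsub
    _ ≤ _ := measureReal_union_le _ _
    _ ≤ _ := by linarith

end Concentration

section Cesaro

variable {X : Type*} [MetricSpace X] [CompactSpace X] [MeasurableSpace X] [BorelSpace X]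
  {T : C(X, X)} {L : C(X, ℝ) →ₗ[ℝ] C(X, ℝ)}

/-- Uniform convergence of the Cesàro averages of `Lᵏ ψ` along a subsequence, by Arzelà-Ascoli: a
limit of averages is harmonic, hence constant. -/
theorem exists_cesaro_close (hL : IsNormalizedTransfer T L) (μ : Measure X)
    [IsProbabilityMeasure μ] (hμ : ∀ h : C(X, ℝ), ∫ x, L h x ∂μ = ∫ x, h x ∂μ)
    (hharm : ∀ h : C(X, ℝ), L h = h → ∃ c, ∀ x, h x = c)
    (ψ : C(X, ℝ)) {K : NNReal} (hK : ∀ k, LipschitzWith K ((L ^ k) ψ)) {η : ℝ} (hη : 0 < η) :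
    ∃ n : ℕ, 0 < n ∧
      ∀ x, |((n : ℝ)⁻¹ • ∑ k ∈ Finset.range n, (L ^ k) ψ) x - ∫ y, ψ y ∂μ| ≤ η := by
  obtain ⟨B, hB⟩ := isCompact_univ.exists_bound_of_continuousOn (f := ψ) ψ.continuous.continuousOn
  replace hB : ∀ x, |ψ x| ≤ B := fun x => hB x trivial
  let A : ℕ → C(X, ℝ) := fun n => ((n + 1 : ℕ) : ℝ)⁻¹ • ∑ k ∈ Finset.range (n + 1), (L ^ k) ψ
  have hAapp : ∀ n x, A n x = ((n + 1 : ℕ) : ℝ)⁻¹ * ∑ k ∈ Finset.range (n + 1), (L ^ k) ψ x := by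
    intro n x; simp [A]
  have hAlip : ∀ n, LipschitzWith K (A n) := by
    intro n
    refine LipschitzWith.of_dist_le_mul fun x y => ?_
    rw [Real.dist_eq, hAapp, hAapp, ← mul_sub, ← Finset.sum_sub_distrib, abs_mul,
      abs_of_pos (by positivity), inv_mul_le_iff₀ (by positivity)]
    refine (Finset.abs_sum_le_sum_abs _ _).trans ((Finset.sum_le_sum (g := fun _ => K * dist x y)
      fun k _ => ?_).trans ?_)
    · have := (hK k).dist_le_mul x y
      rwa [Real.dist_eq] at this
    · simp
  have hAB : ∀ n x, |A n x| ≤ B := by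
    intro n x
    rw [hAapp, abs_mul, abs_of_pos (by positivity), inv_mul_le_iff₀ (by positivity)]
    refine (Finset.abs_sum_le_sum_abs _ _).trans ((Finset.sum_le_sum (g := fun _ => B)
      fun k _ => hL.abs_pow_le hB k x).trans ?_)
    simp
  have hcomp : IsCompact {h : BoundedContinuousFunction X ℝ |
      LipschitzWith K h ∧ ∀ x, |h x| ≤ B} := by
    refine BoundedContinuousFunction.arzela_ascoli₂ (Set.Icc (-B) B) isCompact_Icc _ ?_
      (fun h x hh => abs_le.1 (hh.2 x)) ?_
    · have h1 : IsClosed {h : BoundedContinuousFunction X ℝ | ∀ x, |h x| ≤ B} := by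
        rw [Set.ofPred_forall]
        exact isClosed_iInter fun x => isClosed_le (by fun_prop) continuous_const
      have h2 : IsClosed {h : BoundedContinuousFunction X ℝ | LipschitzWith K h} := by
        have : {h : BoundedContinuousFunction X ℝ | LipschitzWith K h} =
            ⋂ x, ⋂ y, {h : BoundedContinuousFunction X ℝ | dist (h x) (h y) ≤ K * dist x y} := by
          ext h; simp [lipschitzWith_iff_dist_le_mul]
        rw [this]
        exact isClosed_iInter fun x => isClosed_iInter fun y =>
          isClosed_le (by fun_prop) continuous_const
      exact h2.inter h1
    · exact (LipschitzWith.uniformEquicontinuous _ K fun h => h.2.1).equicontinuous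
  obtain ⟨h, -, s, hs, hlim⟩ := hcomp.tendsto_subseq
    (x := fun n => BoundedContinuousFunction.mkOfCompact (A n))
    (fun n => ⟨hAlip n, hAB n⟩)
  set h' : C(X, ℝ) := h.toContinuousMap with hh'
  have hunif : ∀ δ > 0, ∀ᶠ n in atTop, ∀ x, |A (s n) x - h' x| ≤ δ := by
    intro δ hδ
    filter_upwards [(Metric.tendsto_nhds.1 hlim) δ hδ] with n hn x
    have := (BoundedContinuousFunction.dist_coe_le_dist (f := BoundedContinuousFunction.mkOfCompact
      (A (s n))) (g := h) x).trans hn.le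
    rwa [Real.dist_eq] at this
  have hdiff : ∀ n x, |L (A n) x - A n x| ≤ 2 * B / (n + 1 : ℕ) := by
    intro n x
    have h1 : L (A n) - A n = ((n + 1 : ℕ) : ℝ)⁻¹ • ((L ^ (n + 1)) ψ - ψ) := by
      simp only [A]
      rw [map_smul, ← smul_sub, map_sum, ← Finset.sum_sub_distrib]
      have := Finset.sum_range_sub (fun j => (L ^ j) ψ) (n + 1)
      simp only [pow_zero, Module.End.one_apply] at this
      rw [← this]
      refine congrArg _ (Finset.sum_congr rfl fun j _ => ?_)
      rw [pow_succ', Module.End.mul_apply]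
    have h2 := DFunLike.congr_fun h1 x
    simp only [ContinuousMap.sub_apply, ContinuousMap.smul_apply, smul_eq_mul] at h2
    rw [h2, abs_mul, abs_of_pos (by positivity), inv_mul_eq_div]
    gcongr
    have := abs_sub ((L ^ (n + 1)) ψ x) (ψ x)
    linarith [hL.abs_pow_le hB (n + 1) x, hB x]
  have hLh : L h' = h' := by
    ext x
    have hzero : Tendsto (fun n : ℕ => 2 * B / ((s n + 1 : ℕ) : ℝ)) atTop (𝓝 0) :=
      (tendsto_const_div_atTop_nhds_zero_nat (2 * B)).comp
        ((tendsto_add_atTop_nat 1).comp hs.tendsto_atTop)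
    refine eq_of_forall_dist_le fun δ hδ => ?_
    obtain ⟨n, hn1, hn2⟩ := ((hunif (δ / 3) (by positivity)).and
      (hzero.eventually (gt_mem_nhds (show (0 : ℝ) < δ / 3 by positivity)))).exists
    have h1 : |L (A (s n) - h') x| ≤ δ / 3 := hL.abs_le (fun y => by simpa using hn1 y) x
    have h2 := hdiff (s n) x
    have h3 := hn1 x
    rw [map_sub, ContinuousMap.sub_apply] at h1
    rw [Real.dist_eq]
    rw [abs_le] at *
    constructor <;> linarith
  obtain ⟨c, hc⟩ := hharm h' hLh
  have hint : ∀ n, ∫ x, A n x ∂μ = ∫ y, ψ y ∂μ := by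
    intro n
    have hk : ∀ k, ∫ x, (L ^ k) ψ x ∂μ = ∫ y, ψ y ∂μ := by
      intro k
      induction k with
      | zero => simp
      | succ k ih => rw [pow_succ', Module.End.mul_apply, hμ, ih]
    simp_rw [hAapp]
    rw [integral_const_mul, integral_finsetSum _ fun k _ =>
      ContinuousMap.integrable_of_compactSpace μ _, Finset.sum_congr rfl fun k _ => hk k]
    simp only [Finset.sum_const, Finset.card_range, nsmul_eq_mul]
    rw [inv_mul_cancel_left₀ (by positivity)]
  obtain ⟨n, hn⟩ := (hunif (η / 2) (by positivity)).exists
  refine ⟨s n + 1, Nat.succ_pos _, fun x => ?_⟩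
  have hcint : |(∫ y, ψ y ∂μ) - c| ≤ η / 2 := by
    have h1 : (∫ y, ψ y ∂μ) - c = ∫ x, (A (s n) x - c) ∂μ := by
      rw [integral_sub (ContinuousMap.integrable_of_compactSpace μ _) (integrable_const c), hint]
      simp
    rw [h1]
    have := norm_integral_le_of_norm_le_const (μ := μ) (f := fun x => A (s n) x - c) (C := η / 2)
      (ae_of_all _ fun x => by simpa [hc] using hn x)
    simpa using this
  have h1 := hn x
  rw [hc] at h1
  change |A (s n) x - _| ≤ η
  rw [abs_le] at *
  constructor <;> linarith

end Cesaro

/-! ### Transfer operators of expanding systems -/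

section Expanding

/-- The real transfer operator `(L h)(x) = ∑_{T y = x} exp (φ y) h y`. -/
noncomputable def ruelle {X : Type*} (T : X → X) (φ h : X → ℝ) (x : X) : ℝ :=
  ∑ᶠ y ∈ {y | T y = x}, Real.exp (φ y) * h y

/-- An expanding system: a Lipschitz map with finite fibres such that the fibres of `Tⁿ` over
nearby points `x`, `z` are matched by a bijection moving points by at most `C · dist x z`,
and by at most `dist x z / 2` for large `n`; moreover there is no proper nonempty closed
backward invariant set. -/
structure IsExpandingSystem {X : Type*} [MetricSpace X] (T : X → X) : Prop where
  lipschitz : ∃ K, LipschitzWith K T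
  finite_fibre : ∀ x, {y | T y = x}.Finite
  matching : ∃ r > 0, ∃ C : ℝ, 0 ≤ C ∧ ∃ N : ℕ, ∀ (n : ℕ) (x z : X), dist x z < r →
    ∃ τ : X → X, Set.BijOn τ {y | T^[n] y = x} {y | T^[n] y = z} ∧
      ∀ y, T^[n] y = x → dist (τ y) y ≤ C * dist x z ∧ (N ≤ n → dist (τ y) y ≤ 1 / 2 * dist x z)
  eq_univ_of_preimage_subset : ∀ E : Set X, IsClosed E → E.Nonempty → T ⁻¹' E ⊆ E → E = Set.univ

theorem abs_one_sub_exp_le (t : ℝ) : |1 - Real.exp t| ≤ |t| * Real.exp |t| := by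
  rcases le_total 0 t with ht | ht
  · rw [abs_of_nonneg ht, abs_of_nonpos (by linarith [Real.one_le_exp ht])]
    have h1 := Real.add_one_le_exp (-t)
    have h2 : Real.exp (-t) * Real.exp t = 1 := by rw [← Real.exp_add]; simp
    nlinarith [Real.exp_pos t]
  · rw [abs_of_nonpos ht, abs_of_nonneg (by linarith [Real.exp_le_one_iff.2 ht])]
    have h1 := Real.add_one_le_exp t
    have h2 := Real.one_le_exp (show 0 ≤ -t by linarith)
    nlinarith

variable {X : Type*}

theorem ruelle_eq_sum {T : X → X} {x : X} (hfin : {y | T y = x}.Finite) (φ h : X → ℝ) :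
    ruelle T φ h x = ∑ y ∈ hfin.toFinset, Real.exp (φ y) * h y :=
  finsum_mem_eq_finite_toFinset_sum _ hfin

theorem finite_fibre_iterate {T : X → X} (hfin : ∀ x, {y | T y = x}.Finite) (n : ℕ) (x : X) :
    {y | T^[n] y = x}.Finite := by
  induction n generalizing x with
  | zero => simp
  | succ n ih =>
    have : {y | T^[n + 1] y = x} = ⋃ z ∈ {z | T z = x}, {y | T^[n] y = z} := by
      ext y; simp [Function.iterate_succ_apply']
    rw [this]
    exact (hfin x).biUnion fun z _ => ih z

/-- Iterating the transfer operator of `T` gives the transfer operator of `Tⁿ` with weight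
`exp (S_n φ)`. -/
theorem ruelle_iterate {T : X → X} (hfin : ∀ x, {y | T y = x}.Finite) (φ h : X → ℝ) (n : ℕ)
    (x : X) : (ruelle T φ)^[n] h x = ruelle T^[n] (birkhoffSum T φ n) h x := by
  induction n generalizing x with
  | zero => simp [ruelle]
  | succ n ih =>
    rw [Function.iterate_succ_apply']
    have h1 : {y | T^[n + 1] y = x} = ⋃ z ∈ {z | T z = x}, {y | T^[n] y = z} := by
      ext y; simp [Function.iterate_succ_apply']
    unfold ruelle at ih ⊢
    rw [h1, finsum_mem_biUnion _ (hfin x) fun z _ => finite_fibre_iterate hfin n z]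
    · refine finsum_mem_congr rfl fun z _ => ?_
      rw [ih, ← smul_eq_mul, smul_finsum_mem]
      · refine finsum_mem_congr rfl fun y hy => ?_
        rw [birkhoffSum_succ, hy, Real.exp_add, smul_eq_mul]
        ring
      · exact finite_fibre_iterate hfin n z
    · intro z _ z' _ hzz'
      exact Set.disjoint_left.2 fun y hy hy' => hzz' (hy.symm.trans hy')

theorem ruelle_iterate_one {T : X → X} {φ : X → ℝ}
    (hone : ∀ x, ruelle T φ (fun _ => 1) x = 1) (n : ℕ) :
    (ruelle T φ)^[n] (fun _ => 1) = fun _ => 1 := by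
  induction n with
  | zero => rfl
  | succ n ih => rw [Function.iterate_succ_apply', ih]; exact funext hone

/-- Comparison of a normalized transfer operator at two points whose fibres are matched. -/
theorem abs_ruelle_sub_le {F : X → X} {S h : X → ℝ} {x z : X} (hfx : {y | F y = x}.Finite)
    (hone : ruelle F S (fun _ => 1) x = 1) {τ : X → X}
    (hτ : Set.BijOn τ {y | F y = x} {y | F y = z}) {D ω B : ℝ}
    (hS : ∀ y, F y = x → |S (τ y) - S y| ≤ D) (hω : ∀ y, F y = x → |h (τ y) - h y| ≤ ω)
    (hB : ∀ y, |h y| ≤ B) (hD : 0 ≤ D) :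
    |ruelle F S h x - ruelle F S h z| ≤ ω + B * (D * Real.exp D) := by
  have h1 : ruelle F S h z = ∑ y ∈ hfx.toFinset, Real.exp (S (τ y)) * h (τ y) := by
    rw [← finsum_mem_eq_finite_toFinset_sum]
    exact (finsum_mem_eq_of_bijOn τ hτ fun y _ => rfl).symm
  rw [ruelle_eq_sum hfx] at hone ⊢
  simp only [mul_one] at hone
  rw [h1, ← Finset.sum_sub_distrib]
  refine (Finset.abs_sum_le_sum_abs _ _).trans ?_
  calc _ ≤ ∑ y ∈ hfx.toFinset, Real.exp (S y) * (ω + B * (D * Real.exp D)) := by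
        refine Finset.sum_le_sum fun y hy => ?_
        have hy' : F y = x := by simpa using hy
        have e1 : Real.exp (S y) * h y - Real.exp (S (τ y)) * h (τ y) =
            Real.exp (S y) * ((h y - h (τ y)) + (1 - Real.exp (S (τ y) - S y)) * h (τ y)) := by
          rw [Real.exp_sub]; field_simp; ring
        rw [e1, abs_mul, abs_of_pos (Real.exp_pos _)]
        refine mul_le_mul_of_nonneg_left ((abs_add_le _ _).trans (add_le_add ?_ ?_))
          (Real.exp_pos _).le
        · rw [abs_sub_comm]; exact hω y hy'
        · rw [abs_mul, mul_comm]
          refine mul_le_mul (hB _) ((abs_one_sub_exp_le _).trans ?_) (abs_nonneg _)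
            ((abs_nonneg _).trans (hB y))
          exact mul_le_mul (hS y hy') (Real.exp_le_exp.2 (hS y hy')) (Real.exp_pos _).le hD
    _ = _ := by rw [← Finset.sum_mul, hone, one_mul]

variable [MetricSpace X]

theorem exists_lipschitz_birkhoffSum {T : X → X} {K K' : NNReal} {φ : X → ℝ}
    (hT : LipschitzWith K T) (hφ : LipschitzWith K' φ) (n : ℕ) :
    ∃ Q : NNReal, LipschitzWith Q (birkhoffSum T φ n) := by
  induction n with
  | zero => exact ⟨0, by simp⟩
  | succ n ih =>
    obtain ⟨Q, hQ⟩ := ih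
    refine ⟨Q + K' * K ^ n, ?_⟩
    have : birkhoffSum T φ (n + 1) = fun x => birkhoffSum T φ n x + φ (T^[n] x) :=
      funext fun x => birkhoffSum_succ T φ n x
    rw [this]
    exact hQ.add (hφ.comp (hT.iterate n))

namespace IsExpandingSystem

variable {T : X → X} {φ : X → ℝ}

/-- The Lasota-Yorke (Doeblin-Fortet) inequality, for each iterate of the transfer operator; the
Lipschitz constant is halved by high iterates. -/
theorem lasotaYorke (hT : IsExpandingSystem T) {Kφ : NNReal} (hφ : LipschitzWith Kφ φ)
    (hone : ∀ x, ruelle T φ (fun _ => 1) x = 1) :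
    ∃ C : ℝ, 0 ≤ C ∧ ∃ N : ℕ, ∀ n, ∃ D : ℝ, 0 ≤ D ∧ ∀ (h : X → ℝ) (K B : ℝ), 0 ≤ K →
      (∀ x z, |h x - h z| ≤ K * dist x z) → (∀ x, |h x| ≤ B) → ∀ x z,
      |(ruelle T φ)^[n] h x - (ruelle T φ)^[n] h z| ≤ (C * K + D * B) * dist x z ∧
      (N ≤ n → |(ruelle T φ)^[n] h x - (ruelle T φ)^[n] h z| ≤ (1 / 2 * K + D * B) * dist x z) := by
  obtain ⟨KT, hKT⟩ := hT.lipschitz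
  obtain ⟨r, hr, C, hC, N, hτ⟩ := hT.matching
  refine ⟨C, hC, N, fun n => ?_⟩
  obtain ⟨Q, hQ⟩ := exists_lipschitz_birkhoffSum hKT hφ n
  have honen : ∀ x, ruelle T^[n] (birkhoffSum T φ n) (fun _ => 1) x = 1 := fun x => by
    rw [← ruelle_iterate hT.finite_fibre, ruelle_iterate_one hone]
  refine ⟨Q * C * Real.exp (Q * C * r) + 2 / r, by positivity, fun h K B hK hh hB x z => ?_⟩
  have hB0 : 0 ≤ B := (abs_nonneg _).trans (hB x)
  simp only [ruelle_iterate hT.finite_fibre]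
  have hd : 0 ≤ dist x z := dist_nonneg
  rcases lt_or_ge (dist x z) r with hxz | hxz
  · obtain ⟨τ, hbij, hdist⟩ := hτ n x z hxz
    have hS : ∀ y, T^[n] y = x →
        |birkhoffSum T φ n (τ y) - birkhoffSum T φ n y| ≤ Q * (C * dist x z) := fun y hy => by
      have := hQ.dist_le_mul (τ y) y
      rw [Real.dist_eq] at this
      exact this.trans (mul_le_mul_of_nonneg_left (hdist y hy).1 Q.2)
    have hexp : Q * (C * dist x z) * Real.exp (Q * (C * dist x z)) ≤
        Q * C * Real.exp (Q * C * r) * dist x z := by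
      have : Real.exp (Q * (C * dist x z)) ≤ Real.exp (Q * C * r) := by
        apply Real.exp_le_exp.2
        rw [← mul_assoc]
        exact mul_le_mul_of_nonneg_left hxz.le (by positivity)
      calc _ ≤ Q * (C * dist x z) * Real.exp (Q * C * r) :=
            mul_le_mul_of_nonneg_left this (by positivity)
        _ = _ := by ring
    have hrest : 0 ≤ 2 / r * B * dist x z := by positivity
    have key : ∀ a : ℝ, (∀ y, T^[n] y = x → dist (τ y) y ≤ a * dist x z) →
        |ruelle T^[n] (birkhoffSum T φ n) h x - ruelle T^[n] (birkhoffSum T φ n) h z| ≤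
          (a * K + (Q * C * Real.exp (Q * C * r) + 2 / r) * B) * dist x z := by
      intro a ha
      have h1 := abs_ruelle_sub_le (finite_fibre_iterate hT.finite_fibre n x) (honen x) hbij hS
        (h := h) (ω := K * (a * dist x z))
        (fun y hy => (hh _ _).trans (mul_le_mul_of_nonneg_left (ha y hy) hK)) hB (by positivity)
      have h2 := mul_le_mul_of_nonneg_left hexp hB0
      refine h1.trans ?_
      linarith
    exact ⟨key C fun y hy => (hdist y hy).1, fun hn => key _ fun y hy => (hdist y hy).2 hn⟩
  · have hLB : ∀ x, |ruelle T^[n] (birkhoffSum T φ n) h x| ≤ B := by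
      intro x
      have hfx := finite_fibre_iterate hT.finite_fibre n x
      have h1 := honen x
      rw [ruelle_eq_sum hfx] at h1 ⊢
      simp only [mul_one] at h1
      refine (Finset.abs_sum_le_sum_abs _ _).trans ?_
      calc _ ≤ ∑ y ∈ hfx.toFinset, Real.exp (birkhoffSum T φ n y) * B := by
            refine Finset.sum_le_sum fun y _ => ?_
            rw [abs_mul, abs_of_pos (Real.exp_pos _)]
            exact mul_le_mul_of_nonneg_left (hB y) (Real.exp_pos _).le
        _ = B := by rw [← Finset.sum_mul, h1, one_mul]
    have h1 : |ruelle T^[n] (birkhoffSum T φ n) h x - ruelle T^[n] (birkhoffSum T φ n) h z| ≤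
        2 / r * B * dist x z := by
      have h2 := abs_sub (ruelle T^[n] (birkhoffSum T φ n) h x)
        (ruelle T^[n] (birkhoffSum T φ n) h z)
      have h3 : 2 * B ≤ 2 / r * B * dist x z := by
        have : 2 / r * B * dist x z = 2 * B * (dist x z / r) := by ring
        rw [this]
        exact le_mul_of_one_le_right (by positivity) ((one_le_div hr).2 hxz)
      linarith [hLB x, hLB z]
    have h4 : 0 ≤ Q * C * Real.exp (Q * C * r) * B * dist x z := by positivity
    have h5 : 0 ≤ C * K * dist x z := by positivity
    have h6 : 0 ≤ 1 / 2 * K * dist x z := by positivity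
    exact ⟨by linarith, fun _ => by linarith⟩

/-- The iterates of the transfer operator on a Lipschitz function are uniformly Lipschitz. -/
theorem exists_lipschitz_iterate [CompactSpace X] (hT : IsExpandingSystem T) {Kφ : NNReal}
    (hφ : LipschitzWith Kφ φ) (hone : ∀ x, ruelle T φ (fun _ => 1) x = 1) {K₀ : NNReal} {h : X → ℝ}
    (hh : LipschitzWith K₀ h) {B : ℝ} (hB : ∀ k x, |(ruelle T φ)^[k] h x| ≤ B) :
    ∃ K : NNReal, ∀ k, LipschitzWith K ((ruelle T φ)^[k] h) := by
  obtain ⟨C, hC, N, hLY⟩ := hT.lasotaYorke hφ hone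
  choose D hD hLY using hLY
  rcases isEmpty_or_nonempty X with hX | ⟨⟨x₀⟩⟩
  · exact ⟨0, fun k => LipschitzWith.of_dist_le_mul fun x => hX.elim x⟩
  have hB0 : 0 ≤ B := (abs_nonneg _).trans (hB 0 x₀)
  set K : ℝ := C * K₀ + (∑ j ∈ Finset.range (N + 1), D j) * B + 2 * D (N + 1) * B with hK
  have hsum0 : 0 ≤ ∑ j ∈ Finset.range (N + 1), D j := Finset.sum_nonneg fun j _ => hD j
  have hK0 : 0 ≤ K := by have := hD (N + 1); positivity
  refine ⟨⟨K, hK0⟩, fun k => LipschitzWith.of_dist_le_mul fun x z => ?_⟩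
  rw [Real.dist_eq]
  change _ ≤ K * dist x z
  induction k using Nat.strong_induction_on generalizing x z with
  | _ k ih =>
    rcases lt_or_ge k (N + 1) with hk | hk
    · refine (hLY k h K₀ B K₀.2 (fun x z => ?_) (hB 0) x z).1.trans ?_
      · have := hh.dist_le_mul x z
        rwa [Real.dist_eq] at this
      · refine mul_le_mul_of_nonneg_right ?_ dist_nonneg
        have h1 : D k ≤ ∑ j ∈ Finset.range (N + 1), D j :=
          Finset.single_le_sum (fun j _ => hD j) (Finset.mem_range.2 hk)
        have h2 := mul_le_mul_of_nonneg_right h1 hB0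
        have h3 := mul_nonneg (hD (N + 1)) hB0
        rw [hK]; linarith
    · obtain ⟨j, rfl⟩ := Nat.exists_eq_add_of_le hk
      rw [Function.iterate_add_apply]
      refine ((hLY (N + 1) _ K B hK0 (ih j (by omega)) (hB j) x z).2 (by omega)).trans ?_
      refine mul_le_mul_of_nonneg_right ?_ dist_nonneg
      have h3 := mul_nonneg hsum0 hB0
      have h4 := mul_nonneg hC K₀.2
      change 0 ≤ C * (K₀ : ℝ) at h4
      linarith

/-- The transfer operator as an operator on continuous functions. -/
theorem exists_transfer [CompactSpace X] (hT : IsExpandingSystem T) {Kφ : NNReal}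
    (hφ : LipschitzWith Kφ φ) (hone : ∀ x, ruelle T φ (fun _ => 1) x = 1) :
    ∃ L : C(X, ℝ) →ₗ[ℝ] C(X, ℝ), ∀ h x, L h x = ruelle T φ h x := by
  have hcont : ∀ h : C(X, ℝ), Continuous (ruelle T φ h) := by
    intro h
    obtain ⟨B, hB⟩ := isCompact_univ.exists_bound_of_continuousOn (f := h) h.continuous.continuousOn
    obtain ⟨r, hr, C, hC, N, hτ⟩ := hT.matching
    have huc := CompactSpace.uniformContinuous_of_continuous h.continuous
    refine continuous_iff_continuousAt.2 fun x => Metric.continuousAt_iff'.2 fun ε hε => ?_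
    obtain ⟨δ, hδ, hhδ⟩ := Metric.uniformContinuous_iff.1 huc (ε / 2) (by positivity)
    have t1 : Tendsto (fun z => dist x z) (𝓝 x) (𝓝 0) := by
      have : Continuous fun z => dist x z := by fun_prop
      simpa using this.tendsto x
    have t2 : Tendsto (fun z => C * dist x z) (𝓝 x) (𝓝 0) := by simpa using t1.const_mul C
    have t3 : Tendsto (fun z => B * (Kφ * (C * dist x z) * Real.exp (Kφ * (C * dist x z))))
        (𝓝 x) (𝓝 0) := by
      have : Tendsto (fun z => Kφ * (C * dist x z)) (𝓝 x) (𝓝 0) := by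
        simpa using t2.const_mul (Kφ : ℝ)
      simpa using (this.mul ((Real.continuous_exp.tendsto 0).comp this)).const_mul B
    filter_upwards [t1.eventually (gt_mem_nhds hr), t2.eventually (gt_mem_nhds hδ),
      t3.eventually (gt_mem_nhds (show (0 : ℝ) < ε / 2 by positivity))] with z h1 h2 h3
    obtain ⟨τ, hbij, hdist⟩ := hτ 1 x z h1
    have := abs_ruelle_sub_le (hT.finite_fibre x) (hone x) (h := h) (S := φ) hbij
      (D := Kφ * (C * dist x z)) (ω := ε / 2) (B := B) (fun y hy => ?_) (fun y hy => ?_)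
      (fun y => hB y trivial) (by positivity)
    · rw [dist_comm, Real.dist_eq]; linarith
    · have := hφ.dist_le_mul (τ y) y
      rw [Real.dist_eq] at this
      exact this.trans (mul_le_mul_of_nonneg_left (hdist y hy).1 Kφ.2)
    · have := hhδ ((hdist y hy).1.trans_lt h2)
      rw [Real.dist_eq] at this
      exact this.le
  refine ⟨{ toFun := fun h => ⟨ruelle T φ h, hcont h⟩, map_add' := ?_, map_smul' := ?_ },
    fun h x => rfl⟩
  · intro g h
    ext x
    simp [ruelle_eq_sum (hT.finite_fibre x), mul_add, Finset.sum_add_distrib]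
  · intro c h
    ext x
    simp [ruelle_eq_sum (hT.finite_fibre x), Finset.mul_sum, mul_left_comm]

/-- The maximum principle: the points where a harmonic function is maximal form a closed backward
invariant set. -/
theorem exists_const_of_harmonic [CompactSpace X] (hT : IsExpandingSystem T)
    (hone : ∀ x, ruelle T φ (fun _ => 1) x = 1) (h : C(X, ℝ)) (hh : ∀ x, ruelle T φ h x = h x) :
    ∃ c, ∀ x, h x = c := by
  rcases isEmpty_or_nonempty X with hX | hX
  · exact ⟨0, fun x => hX.elim x⟩
  obtain ⟨x₀, -, hx₀⟩ := isCompact_univ.exists_isMaxOn Set.univ_nonempty h.continuous.continuousOn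
  have hmax : ∀ y, h y ≤ h x₀ := fun y => hx₀ (Set.mem_univ y)
  refine ⟨h x₀, fun x => ?_⟩
  have hE : {x | h x = h x₀} = Set.univ := by
    refine hT.eq_univ_of_preimage_subset _ (isClosed_eq h.continuous continuous_const) ⟨x₀, rfl⟩ ?_
    intro y (hy : h (T y) = h x₀)
    have hfin := hT.finite_fibre (T y)
    have h1 := hh (T y)
    have h2 := hone (T y)
    rw [ruelle_eq_sum hfin] at h1 h2
    simp only [mul_one] at h2
    have h3 : ∑ z ∈ hfin.toFinset, Real.exp (φ z) * (h x₀ - h z) = 0 := by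
      simp only [mul_sub, Finset.sum_sub_distrib]
      rw [← Finset.sum_mul, h2, h1, hy]; ring
    rw [Finset.sum_eq_zero_iff_of_nonneg fun z _ =>
      mul_nonneg (Real.exp_pos _).le (by linarith [hmax z])] at h3
    have h4 := h3 y (by simp)
    have h5 := (mul_eq_zero.1 h4).resolve_left (Real.exp_pos _).ne'
    change h y = h x₀
    linarith
  exact (Set.ext_iff.1 hE x).2 trivial

/-- Large deviations for expanding systems and normalized Lipschitz potentials. -/
theorem exists_measureReal_birkhoffSum_le [CompactSpace X] [MeasurableSpace X] [BorelSpace X]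
    (hT : IsExpandingSystem T) {Kφ : NNReal} (hφ : LipschitzWith Kφ φ)
    (hone : ∀ x, ruelle T φ (fun _ => 1) x = 1) (μ : Measure X) [IsProbabilityMeasure μ]
    (hμ : ∀ h : C(X, ℝ), ∫ x, ruelle T φ h x ∂μ = ∫ x, h x ∂μ) {Kψ : NNReal} {ψ : X → ℝ}
    (hψ : LipschitzWith Kψ ψ) {ε : ℝ} (hε : 0 < ε) :
    ∃ C δ : ℝ, 0 < C ∧ 0 < δ ∧ ∀ n : ℕ, 1 ≤ n →
      μ.real {x | |birkhoffSum T ψ n x / n - ∫ y, ψ y ∂μ| > ε} ≤ C * Real.exp (-(n * δ)) := by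
  obtain ⟨L, hL⟩ := hT.exists_transfer hφ hone
  obtain ⟨KT, hKT⟩ := hT.lipschitz
  have hN : IsNormalizedTransfer ⟨T, hKT.continuous⟩ L := by
    refine ⟨fun h hh x => ?_, ?_, fun g h => ?_⟩
    · rw [hL, ruelle_eq_sum (hT.finite_fibre x)]
      exact Finset.sum_nonneg fun y _ => mul_nonneg (Real.exp_pos _).le (hh y)
    · ext x; rw [hL]; exact hone x
    · ext x
      rw [hL, ContinuousMap.mul_apply, hL, ruelle_eq_sum (hT.finite_fibre x),
        ruelle_eq_sum (hT.finite_fibre x), Finset.sum_mul]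
      refine Finset.sum_congr rfl fun y hy => ?_
      have hy' : T y = x := by simpa using hy
      simp [hy', mul_assoc]
  have hpow : ∀ k (h : C(X, ℝ)), ((L ^ k) h : X → ℝ) = (ruelle T φ)^[k] h := by
    intro k h
    induction k with
    | zero => simp
    | succ k ih =>
      rw [pow_succ', Module.End.mul_apply, Function.iterate_succ_apply', ← ih]
      exact funext (hL _)
  have hμL : ∀ h : C(X, ℝ), ∫ x, L h x ∂μ = ∫ x, h x ∂μ := fun h => by
    simp_rw [hL]; exact hμ h
  let ψ' : C(X, ℝ) := ⟨ψ, hψ.continuous⟩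
  obtain ⟨B, hB⟩ := isCompact_univ.exists_bound_of_continuousOn (f := ψ') hψ.continuous.continuousOn
  obtain ⟨K, hK⟩ := hT.exists_lipschitz_iterate hφ hone hψ (B := B) (fun k x => by
    have := hN.abs_pow_le (h := ψ') (fun x => hB x trivial) k x
    rwa [hpow] at this)
  refine HypJulia.exists_measureReal_birkhoffSum_le hN μ hμL ψ' _ (fun η hη => ?_) hε
  refine exists_cesaro_close hN μ hμL (fun h hh => ?_) ψ' (K := K) (fun k => ?_) hη
  · exact hT.exists_const_of_harmonic hone h fun x => by rw [← hL, hh]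
  · rw [hpow]; exact hK k

end IsExpandingSystem

end Expanding

/-! ### Holomorphic maps into the Riemann sphere -/

section Sphere

theorem ratio_of_ne_zero {b : ℂ} (a : ℂ) (hb : b ≠ 0) :
    ratio a b = ((a / b : ℂ) : OnePoint ℂ) := if_neg hb

@[simp] theorem ratio_zero_right (a : ℂ) : ratio a 0 = (∞ : OnePoint ℂ) := if_pos rfl

@[simp] theorem ratio_one_right (a : ℂ) : ratio a 1 = (a : OnePoint ℂ) := by
  rw [ratio_of_ne_zero a one_ne_zero, div_one]

theorem ratio_mul_left {c : ℂ} (hc : c ≠ 0) (a b : ℂ) : ratio (c * a) (c * b) = ratio a b := by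
  by_cases hb : b = 0
  · simp [hb]
  · rw [ratio_of_ne_zero _ hb, ratio_of_ne_zero _ (mul_ne_zero hc hb), mul_div_mul_left _ _ hc]

@[simp] theorem sphereInv_infty : sphereInv (∞ : OnePoint ℂ) = ((0 : ℂ) : OnePoint ℂ) := rfl

@[simp] theorem sphereInv_coe (z : ℂ) : sphereInv (z : OnePoint ℂ) = ratio 1 z := rfl

@[simp] theorem toPlane_coe (z : ℂ) : toPlane (z : OnePoint ℂ) = z := rfl

theorem coe_toPlane {x : OnePoint ℂ} (hx : x ≠ (∞ : OnePoint ℂ)) :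
    (toPlane x : OnePoint ℂ) = x := by
  obtain ⟨z, rfl⟩ := OnePoint.ne_infty_iff_exists.1 hx
  rfl

theorem sphereInv_ratio {a b : ℂ} (h : a ≠ 0 ∨ b ≠ 0) : sphereInv (ratio a b) = ratio b a := by
  by_cases hb : b = 0
  · have ha : a ≠ 0 := h.resolve_right (not_not.2 hb)
    rw [hb, ratio_zero_right, sphereInv_infty, ratio_of_ne_zero _ ha, zero_div]
  · rw [ratio_of_ne_zero a hb, sphereInv_coe, ← ratio_mul_left hb 1 (a / b), mul_one,
      mul_div_cancel₀ _ hb]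

theorem exists_eq_ratio (x : OnePoint ℂ) : ∃ a b : ℂ, (a ≠ 0 ∨ b ≠ 0) ∧ x = ratio a b := by
  induction x using OnePoint.rec with
  | infty => exact ⟨1, 0, Or.inl one_ne_zero, by simp⟩
  | coe z => exact ⟨z, 1, Or.inr one_ne_zero, by simp⟩

theorem sphereInv_sphereInv (x : OnePoint ℂ) : sphereInv (sphereInv x) = x := by
  obtain ⟨a, b, h, rfl⟩ := exists_eq_ratio x
  rw [sphereInv_ratio h, sphereInv_ratio h.symm]

theorem continuous_sphereInv : Continuous sphereInv := by
  refine continuous_iff_continuousAt.2 fun x => ?_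
  induction x using OnePoint.rec with
  | infty =>
    rw [OnePoint.continuousAt_infty', coclosedCompact_eq_cocompact, ← Metric.cobounded_eq_cocompact]
    have h1 : Tendsto (fun z : ℂ => ((z⁻¹ : ℂ) : OnePoint ℂ)) (Bornology.cobounded ℂ)
        (𝓝 (sphereInv (∞ : OnePoint ℂ))) :=
      (OnePoint.continuous_coe.tendsto 0).comp tendsto_inv₀_cobounded
    refine h1.congr' ?_
    filter_upwards [Bornology.eventually_ne_cobounded (0 : ℂ)] with z hz
    simp [ratio_of_ne_zero _ hz]
  | coe z =>
    rw [OnePoint.continuousAt_coe]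
    by_cases hz : z = 0
    · subst hz
      rw [continuousAt_iff_punctured_nhds]
      have h1 : Tendsto (fun z : ℂ => ((z⁻¹ : ℂ) : OnePoint ℂ)) (𝓝[≠] 0) (𝓝 (∞ : OnePoint ℂ)) := by
        refine OnePoint.tendsto_coe_infty.comp ?_
        rw [coclosedCompact_eq_cocompact, ← Metric.cobounded_eq_cocompact]
        exact tendsto_inv₀_nhdsNE_zero
      simp only [Function.comp_apply, sphereInv_coe, ratio_zero_right]
      refine h1.congr' ?_
      filter_upwards [self_mem_nhdsWithin] with z hz
      simp [ratio_of_ne_zero _ hz]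
    · have h1 : ContinuousAt (fun z : ℂ => ((z⁻¹ : ℂ) : OnePoint ℂ)) z :=
        OnePoint.continuous_coe.continuousAt.comp (continuousAt_inv₀ hz)
      refine h1.congr ?_
      filter_upwards [isOpen_ne.mem_nhds hz] with w hw
      simp [ratio_of_ne_zero _ hw]

/-- The inversion of the sphere as a homeomorphism. -/
noncomputable def sphereInvHomeo : OnePoint ℂ ≃ₜ OnePoint ℂ where
  toFun := sphereInv
  invFun := sphereInv
  left_inv := sphereInv_sphereInv
  right_inv := sphereInv_sphereInv
  continuous_toFun := continuous_sphereInv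
  continuous_invFun := continuous_sphereInv

/-- A map from the plane to the sphere is holomorphic at `z` if near `z` it has analytic
homogeneous coordinates without common zero. -/
def SphAt (h : ℂ → OnePoint ℂ) (z : ℂ) : Prop :=
  ∃ u v : ℂ → ℂ, AnalyticAt ℂ u z ∧ AnalyticAt ℂ v z ∧ (u z ≠ 0 ∨ v z ≠ 0) ∧
    ∀ᶠ w in 𝓝 z, h w = ratio (u w) (v w)

namespace SphAt

variable {h : ℂ → OnePoint ℂ} {z : ℂ}

theorem eventually_ne_zero {u v : ℂ → ℂ} (hu : AnalyticAt ℂ u z) (hv : AnalyticAt ℂ v z)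
    (h0 : u z ≠ 0 ∨ v z ≠ 0) : ∀ᶠ w in 𝓝 z, u w ≠ 0 ∨ v w ≠ 0 := by
  rcases h0 with h0 | h0
  · exact (hu.continuousAt.eventually_ne h0).mono fun _ => Or.inl
  · exact (hv.continuousAt.eventually_ne h0).mono fun _ => Or.inr

theorem coe {g : ℂ → ℂ} (hg : AnalyticAt ℂ g z) : SphAt (fun w => (g w : OnePoint ℂ)) z :=
  ⟨g, fun _ => 1, hg, analyticAt_const, Or.inr one_ne_zero, Eventually.of_forall fun w => by simp⟩

theorem inv (hh : SphAt h z) : SphAt (fun w => sphereInv (h w)) z := by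
  obtain ⟨u, v, hu, hv, h0, he⟩ := hh
  refine ⟨v, u, hv, hu, h0.symm, ?_⟩
  filter_upwards [he, eventually_ne_zero hu hv h0] with w h1 h2
  rw [h1, sphereInv_ratio h2]

theorem comp {g : ℂ → ℂ} (hh : SphAt h (g z)) (hg : AnalyticAt ℂ g z) :
    SphAt (fun w => h (g w)) z := by
  obtain ⟨u, v, hu, hv, h0, he⟩ := hh
  exact ⟨u ∘ g, v ∘ g, hu.comp hg, hv.comp hg, h0, hg.continuousAt.eventually he⟩

/-- A holomorphic map to the sphere with a finite value is given by an analytic function. -/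
theorem exists_analyticAt (hh : SphAt h z) (hz : h z ≠ (∞ : OnePoint ℂ)) :
    AnalyticAt ℂ (fun w => toPlane (h w)) z ∧
      ∀ᶠ w in 𝓝 z, h w = ((toPlane (h w) : ℂ) : OnePoint ℂ) := by
  obtain ⟨u, v, hu, hv, h0, he⟩ := hh
  have hvz : v z ≠ 0 := fun hv0 => hz (by rw [he.self_of_nhds, hv0, ratio_zero_right])
  have h1 : ∀ᶠ w in 𝓝 z, h w = ((u w / v w : ℂ) : OnePoint ℂ) := by
    filter_upwards [he, hv.continuousAt.eventually_ne hvz] with w h1 h2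
    rw [h1, ratio_of_ne_zero _ h2]
  refine ⟨(hu.fun_div hv hvz).congr ?_, ?_⟩
  · filter_upwards [h1] with w hw
    rw [hw, toPlane_coe]
  · filter_upwards [h1] with w hw
    rw [hw, toPlane_coe]

theorem continuousAt_of_ne_infty (hh : SphAt h z) (hz : h z ≠ (∞ : OnePoint ℂ)) :
    ContinuousAt h z := by
  obtain ⟨ha, he⟩ := hh.exists_analyticAt hz
  exact (OnePoint.continuous_coe.continuousAt.comp ha.continuousAt).congr
    (he.mono fun w hw => hw.symm)

theorem ne_infty_or (h : ℂ → OnePoint ℂ) (z : ℂ) :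
    h z ≠ (∞ : OnePoint ℂ) ∨ sphereInv (h z) ≠ (∞ : OnePoint ℂ) := by
  by_cases hz : h z = (∞ : OnePoint ℂ)
  · right; rw [hz, sphereInv_infty]; exact OnePoint.coe_ne_infty _
  · exact Or.inl hz

theorem continuousAt (hh : SphAt h z) : ContinuousAt h z := by
  rcases ne_infty_or h z with hz | hz
  · exact hh.continuousAt_of_ne_infty hz
  · have := continuous_sphereInv.continuousAt.comp (hh.inv.continuousAt_of_ne_infty hz)
    exact this.congr (Eventually.of_forall fun w => sphereInv_sphereInv (h w))

theorem eventually_const_or_nhds_le_of_ne_infty (hh : SphAt h z) (hz : h z ≠ (∞ : OnePoint ℂ)) :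
    (∀ᶠ w in 𝓝 z, h w = h z) ∨ 𝓝 (h z) ≤ map h (𝓝 z) := by
  obtain ⟨ha, he⟩ := hh.exists_analyticAt hz
  rcases ha.eventually_constant_or_nhds_le_map_nhds with h1 | h1
  · left
    filter_upwards [he, h1] with w h2 h3
    rw [h2, h3, coe_toPlane hz]
  · right
    have h2 : map h (𝓝 z) = map ((↑) : ℂ → OnePoint ℂ) (map (fun w => toPlane (h w)) (𝓝 z)) := by
      rw [map_map]
      exact map_congr he
    rw [h2]
    have h3 : 𝓝 (h z) = map ((↑) : ℂ → OnePoint ℂ) (𝓝 (toPlane (h z))) := by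
      rw [← OnePoint.nhds_coe_eq, coe_toPlane hz]
    rw [h3]
    exact map_mono h1

/-- The open mapping theorem for holomorphic maps to the sphere. -/
theorem eventually_const_or_nhds_le (hh : SphAt h z) :
    (∀ᶠ w in 𝓝 z, h w = h z) ∨ 𝓝 (h z) ≤ map h (𝓝 z) := by
  rcases ne_infty_or h z with hz | hz
  · exact hh.eventually_const_or_nhds_le_of_ne_infty hz
  · rcases hh.inv.eventually_const_or_nhds_le_of_ne_infty hz with h1 | h1
    · left
      filter_upwards [h1] with w hw
      rw [← sphereInv_sphereInv (h w), hw, sphereInv_sphereInv]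
    · right
      have h2 := map_mono (m := sphereInv) h1
      have h3 : map sphereInv (𝓝 (sphereInv (h z))) = 𝓝 (h z) := by
        have := sphereInvHomeo.map_nhds_eq (sphereInv (h z))
        simpa [sphereInvHomeo, sphereInv_sphereInv] using this
      rw [h3, Filter.map_map] at h2
      convert h2 using 2
      funext w
      exact (sphereInv_sphereInv (h w)).symm

end SphAt

end Sphere

/-! ### Rational maps -/

section Rational

open Polynomial

/-- The value at `(u, v)` of the homogenization of `p` in degree `d`. -/
noncomputable def homEval (p : ℂ[X]) (d : ℕ) (u v : ℂ) : ℂ :=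
  ∑ k ∈ Finset.range (d + 1), p.coeff k * u ^ k * v ^ (d - k)

theorem homEval_of_ne_zero {p : ℂ[X]} {d : ℕ} (hp : p.natDegree ≤ d) (u : ℂ) {v : ℂ} (hv : v ≠ 0) :
    homEval p d u v = v ^ d * p.eval (u / v) := by
  rw [homEval, Polynomial.eval_eq_sum_range' (Nat.lt_succ_of_le hp), Finset.mul_sum]
  refine Finset.sum_congr rfl fun k hk => ?_
  have hkd : k ≤ d := Nat.lt_succ_iff.1 (Finset.mem_range.1 hk)
  rw [div_pow, ← Nat.sub_add_cancel hkd, pow_add, Nat.add_sub_cancel]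
  field_simp

theorem homEval_zero_right (p : ℂ[X]) (d : ℕ) (u : ℂ) : homEval p d u 0 = p.coeff d * u ^ d := by
  rw [homEval, Finset.sum_range_succ, Finset.sum_eq_zero, zero_add, Nat.sub_self, pow_zero, mul_one]
  intro k hk
  rw [zero_pow (Nat.sub_ne_zero_of_lt (Finset.mem_range.1 hk)), mul_zero]

variable {p q : ℂ[X]}

theorem coeff_max_natDegree_ne_zero (hpq : IsCoprime p q) :
    p.coeff (max p.natDegree q.natDegree) ≠ 0 ∨ q.coeff (max p.natDegree q.natDegree) ≠ 0 := by
  by_cases hp : p = 0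
  · subst hp
    have hq : IsUnit q := isCoprime_zero_left.1 hpq
    right
    simp [hq.ne_zero]
  by_cases hq : q = 0
  · subst hq
    left
    simp [hp]
  rcases le_total p.natDegree q.natDegree with h | h
  · right; rw [max_eq_right h]; simpa using hq
  · left; rw [max_eq_left h]; simpa using hp

theorem homEval_ne_zero (hpq : IsCoprime p q) {u v : ℂ} (h : u ≠ 0 ∨ v ≠ 0) :
    homEval p (max p.natDegree q.natDegree) u v ≠ 0 ∨
      homEval q (max p.natDegree q.natDegree) u v ≠ 0 := by
  by_cases hv : v = 0
  · have hu : u ≠ 0 := h.resolve_right (not_not.2 hv)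
    rw [hv, homEval_zero_right, homEval_zero_right]
    exact (coeff_max_natDegree_ne_zero hpq).imp (fun h => mul_ne_zero h (pow_ne_zero _ hu))
      fun h => mul_ne_zero h (pow_ne_zero _ hu)
  · rw [homEval_of_ne_zero (le_max_left _ _) _ hv, homEval_of_ne_zero (le_max_right _ _) _ hv]
    by_contra! hcon
    have h1 := (mul_eq_zero.1 hcon.1).resolve_left (pow_ne_zero _ hv)
    have h2 := (mul_eq_zero.1 hcon.2).resolve_left (pow_ne_zero _ hv)
    obtain ⟨a, b, hab⟩ := hpq
    have := congrArg (Polynomial.eval (u / v)) hab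
    simp [h1, h2] at this

theorem ratEval_ratio (p q : ℂ[X]) {u v : ℂ} (h : u ≠ 0 ∨ v ≠ 0) :
    ratEval p q (ratio u v) = ratio (homEval p (max p.natDegree q.natDegree) u v)
      (homEval q (max p.natDegree q.natDegree) u v) := by
  by_cases hv : v = 0
  · have hu : u ≠ 0 := h.resolve_right (not_not.2 hv)
    rw [hv, homEval_zero_right, homEval_zero_right, mul_comm, mul_comm (q.coeff _),
      ratio_mul_left (pow_ne_zero _ hu), ratio_zero_right]
    rfl
  · rw [homEval_of_ne_zero (le_max_left _ _) _ hv, homEval_of_ne_zero (le_max_right _ _) _ hv,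
      ratio_mul_left (pow_ne_zero _ hv), ratio_of_ne_zero _ hv]
    rfl

theorem analyticAt_homEval (p : ℂ[X]) (d : ℕ) {u v : ℂ → ℂ} {z : ℂ} (hu : AnalyticAt ℂ u z)
    (hv : AnalyticAt ℂ v z) : AnalyticAt ℂ (fun w => homEval p d (u w) (v w)) z := by
  unfold homEval
  exact Finset.analyticAt_fun_sum _ fun k _ =>
    (analyticAt_const.fun_mul (hu.fun_pow k)).fun_mul (hv.fun_pow (d - k))

variable {f : OnePoint ℂ → OnePoint ℂ} {d : ℕ}

/-- Composing with a rational map preserves holomorphy: the map is polynomial in homogeneous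
coordinates. -/
theorem SphAt.rational (hf : IsRationalMap f d) {h : ℂ → OnePoint ℂ} {z : ℂ} (hh : SphAt h z) :
    SphAt (fun w => f (h w)) z := by
  obtain ⟨p, q, hpq, -, rfl⟩ := hf
  obtain ⟨u, v, hu, hv, h0, he⟩ := hh
  refine ⟨_, _, analyticAt_homEval p (max p.natDegree q.natDegree) hu hv,
    analyticAt_homEval q (max p.natDegree q.natDegree) hu hv, homEval_ne_zero hpq h0, ?_⟩
  filter_upwards [he, eventually_ne_zero hu hv h0] with w h1 h2
  rw [h1, ratEval_ratio _ _ h2]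

theorem SphAt.iterate (hf : IsRationalMap f d) (n : ℕ) {h : ℂ → OnePoint ℂ} {z : ℂ}
    (hh : SphAt h z) : SphAt (fun w => f^[n] (h w)) z := by
  induction n with
  | zero => simpa using hh
  | succ n ih => simpa only [Function.iterate_succ_apply'] using ih.rational hf

theorem sphAt_coe (z : ℂ) : SphAt (fun w => (w : OnePoint ℂ)) z := SphAt.coe analyticAt_id

theorem sphAt_sphereInv_coe (z : ℂ) : SphAt (fun w => sphereInv (w : OnePoint ℂ)) z :=
  (sphAt_coe z).inv

theorem map_sphereInv_coe_nhds_zero :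
    map (fun w : ℂ => sphereInv (w : OnePoint ℂ)) (𝓝 0) = 𝓝 (∞ : OnePoint ℂ) := by
  have h1 : (fun w : ℂ => sphereInv (w : OnePoint ℂ)) = sphereInvHomeo ∘ ((↑) : ℂ → OnePoint ℂ) :=
    rfl
  rw [h1, ← Filter.map_map, ← OnePoint.nhds_coe_eq, Homeomorph.map_nhds_eq]
  simp [sphereInvHomeo]

namespace IsRationalMap

theorem continuous (hf : IsRationalMap f d) : Continuous f := by
  refine continuous_iff_continuousAt.2 fun x => ?_
  induction x using OnePoint.rec with
  | infty =>
    have h1 := ((sphAt_sphereInv_coe 0).rational hf).continuousAt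
    have h2 : sphereInv ((0 : ℂ) : OnePoint ℂ) = (∞ : OnePoint ℂ) := by simp
    rw [ContinuousAt, h2] at h1
    rw [ContinuousAt, ← map_sphereInv_coe_nhds_zero, tendsto_map'_iff]
    exact h1
  | coe z =>
    rw [OnePoint.continuousAt_coe]
    exact ((sphAt_coe z).rational hf).continuousAt

/-- The finite points of a fibre `p / q = [a : b]` are roots of the polynomial `a q - b p`, which
is not zero because `p` and `q` are coprime and not both constant. -/
theorem finite_fibre (hf : IsRationalMap f d) (hd : d ≠ 0) (c : OnePoint ℂ) :
    {z : ℂ | f (z : OnePoint ℂ) = c}.Finite := by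
  obtain ⟨p, q, hpq, hmax, rfl⟩ := hf
  have key : ∀ a b : ℂ, (a ≠ 0 ∨ b ≠ 0) → C a * q - C b * p ≠ 0 := by
    intro a b hab h0
    have h1 : C a * q = C b * p := sub_eq_zero.1 h0
    have hunit : ∀ {s t : ℂ[X]} {α β : ℂ}, IsCoprime s t → α ≠ 0 → C α * t = C β * s →
        s.natDegree = 0 ∧ t.natDegree = 0 := by
      intro s t α β hst hα hst'
      have hdvd : s ∣ t := by
        refine ⟨C (α⁻¹ * β), ?_⟩
        have := congrArg (fun r => C α⁻¹ * r) hst'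
        simp only [← mul_assoc, ← C_mul] at this
        rw [inv_mul_cancel₀ hα, C_1, one_mul] at this
        rw [this]; ring
      have hs : s.natDegree = 0 := natDegree_eq_zero_of_isUnit (hst.isUnit_of_dvd' dvd_rfl hdvd)
      refine ⟨hs, ?_⟩
      have : t.natDegree = (C α * t).natDegree := (natDegree_C_mul hα).symm
      rw [this, hst']
      exact Nat.le_zero.1 ((natDegree_C_mul_le _ _).trans hs.le)
    rcases hab with ha | hb
    · have := hunit hpq ha h1
      omega
    · have := hunit hpq.symm hb h1.symm
      omega
  obtain ⟨a, b, hab, rfl⟩ := exists_eq_ratio c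
  refine (((C a * q - C b * p).roots.toFinset).finite_toSet).subset fun z hz => ?_
  simp only [Finset.mem_coe, Multiset.mem_toFinset, mem_roots (key a b hab), IsRoot.def, eval_sub,
    eval_mul, eval_C]
  change ratio (p.eval z) (q.eval z) = ratio a b at hz
  by_cases hb : b = 0
  · rw [hb, ratio_zero_right] at hz
    have hq : q.eval z = 0 := by
      by_contra hq
      rw [ratio_of_ne_zero _ hq] at hz
      exact OnePoint.coe_ne_infty _ hz
    simp [hb, hq]
  · have hq : q.eval z ≠ 0 := by
      intro hq
      rw [hq, ratio_zero_right, ratio_of_ne_zero _ hb] at hz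
      exact OnePoint.infty_ne_coe _ hz
    rw [ratio_of_ne_zero _ hb, ratio_of_ne_zero _ hq, OnePoint.coe_eq_coe,
      div_eq_div_iff hq hb] at hz
    rw [sub_eq_zero, mul_comm b, hz]

theorem isOpenMap (hf : IsRationalMap f d) (hd : d ≠ 0) : IsOpenMap f := by
  refine IsOpenMap.of_nhds_le fun x => ?_
  have hinf : ∀ {S : Set ℂ} {z : ℂ}, S ∈ 𝓝 z → S.Infinite := fun hS =>
    infinite_of_mem_nhds _ hS
  induction x using OnePoint.rec with
  | infty =>
    have h2 : sphereInv ((0 : ℂ) : OnePoint ℂ) = (∞ : OnePoint ℂ) := by simp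
    rcases ((sphAt_sphereInv_coe 0).rational hf).eventually_const_or_nhds_le with h | h
    · exfalso
      rw [h2] at h
      have h3 := (hinf h).sdiff (Set.finite_singleton (0 : ℂ))
      have h4 := h3.image (f := fun z : ℂ => z⁻¹) inv_injective.injOn
      refine h4 ((hf.finite_fibre hd (f (∞ : OnePoint ℂ))).subset ?_)
      rintro _ ⟨z, ⟨hz, hz0⟩, rfl⟩
      have hz' : f (sphereInv (z : OnePoint ℂ)) = f (∞ : OnePoint ℂ) := hz
      rw [sphereInv_coe, ratio_of_ne_zero _ (by simpa using hz0), one_div] at hz'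
      exact hz'
    · rw [h2] at h
      rw [← map_sphereInv_coe_nhds_zero, Filter.map_map]
      exact h
  | coe z =>
    rcases ((sphAt_coe z).rational hf).eventually_const_or_nhds_le with h | h
    · exact absurd (hf.finite_fibre hd _) (hinf h)
    · rw [OnePoint.nhds_coe_eq, Filter.map_map]
      exact h

end IsRationalMap

end Rational

/-! ### Local inverses of analytic functions and existence of critical points -/

section LocalInverse

/-- A continuous local right inverse of an analytic function is analytic: the derivative vanishes
at isolated points only, and these are removable singularities of the inverse. -/
theorem analyticAt_of_comp_eq {Φ G : ℂ → ℂ} {w₀ : ℂ} (hΦ : AnalyticAt ℂ Φ (G w₀))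
    (hG : ∀ᶠ w in 𝓝 w₀, ContinuousAt G w) (h : ∀ᶠ w in 𝓝 w₀, Φ (G w) = w) :
    AnalyticAt ℂ G w₀ := by
  have hG₀ : ContinuousAt G w₀ := hG.self_of_nhds
  have hne : ∀ᶠ z in 𝓝[≠] (G w₀), deriv Φ z ≠ 0 := by
    refine hΦ.deriv.eventually_eq_zero_or_eventually_ne_zero.resolve_left fun h0 => ?_
    obtain ⟨δ, hδ, hball⟩ := Metric.eventually_nhds_iff_ball.1 (h0.and hΦ.eventually_analyticAt)
    have hconst : ∀ z ∈ Metric.ball (G w₀) δ, Φ z = Φ (G w₀) := fun z hz =>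
      Metric.isOpen_ball.is_const_of_deriv_eq_zero (convex_ball _ _).isPreconnected
        (fun y hy => (hball y hy).2.differentiableAt.differentiableWithinAt)
        (fun y hy => (hball y hy).1) hz (Metric.mem_ball_self hδ)
    have h1 : ∀ᶠ w in 𝓝 w₀, w = w₀ := by
      filter_upwards [h, hG₀.eventually (Metric.ball_mem_nhds _ hδ)] with w hw hwb
      rw [← hw, hconst _ hwb, h.self_of_nhds]
    obtain ⟨w, hw, hw'⟩ := ((h1.filter_mono nhdsWithin_le_nhds).and
      (self_mem_nhdsWithin (s := {w₀}ᶜ) (a := w₀))).exists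
    exact hw' hw
  have hpunct : Tendsto G (𝓝[≠] w₀) (𝓝[≠] (G w₀)) := by
    refine tendsto_nhdsWithin_iff.2 ⟨hG₀.tendsto.mono_left nhdsWithin_le_nhds, ?_⟩
    filter_upwards [h.filter_mono nhdsWithin_le_nhds, self_mem_nhdsWithin] with w hw hw0 heq
    exact hw0 (by rw [Set.mem_singleton_iff, ← hw, heq, h.self_of_nhds])
  refine Complex.analyticAt_of_differentiable_on_punctured_nhds_of_continuousAt ?_ hG₀
  filter_upwards [hpunct.eventually hne, hG.filter_mono nhdsWithin_le_nhds,
    h.eventually_nhds.filter_mono nhdsWithin_le_nhds,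
    (hG₀.eventually hΦ.eventually_analyticAt).filter_mono nhdsWithin_le_nhds] with w h1 h2 h3 h4
  exact (HasDerivAt.of_local_left_inverse h2 h4.differentiableAt.hasDerivAt h1 h3).differentiableAt

theorem deriv_mul_deriv_of_comp_eq {Φ G : ℂ → ℂ} {w₀ : ℂ} (hΦ : AnalyticAt ℂ Φ (G w₀))
    (hG : AnalyticAt ℂ G w₀) (h : ∀ᶠ w in 𝓝 w₀, Φ (G w) = w) :
    deriv Φ (G w₀) * deriv G w₀ = 1 := by
  have h1 := (hΦ.differentiableAt.hasDerivAt.comp w₀ hG.differentiableAt.hasDerivAt)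
  exact h1.unique ((hasDerivAt_id w₀).congr_of_eventuallyEq h)

/-- The derivative of an injective analytic function does not vanish, since its inverse is
analytic. -/
theorem deriv_ne_zero_of_injOn {Φ : ℂ → ℂ} {z₀ : ℂ} (hΦ : AnalyticAt ℂ Φ z₀) {S : Set ℂ}
    (hS : S ∈ 𝓝 z₀) (hinj : Set.InjOn Φ S) : deriv Φ z₀ ≠ 0 := by
  obtain ⟨O, hOS, hO, hz₀⟩ := mem_nhds_iff.1 (inter_mem hS hΦ.eventually_analyticAt)
  have hinjO : Set.InjOn Φ O := hinj.mono fun x hx => (hOS hx).1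
  have hopen : ∀ z ∈ O, 𝓝 (Φ z) ≤ map Φ (𝓝 z) := by
    intro z hz
    refine (AnalyticAt.eventually_constant_or_nhds_le_map_nhds (hOS hz).2).resolve_left fun hc => ?_
    obtain ⟨w, ⟨hw, hwO⟩, hwz⟩ := (((hc.and (hO.mem_nhds hz)).filter_mono
      nhdsWithin_le_nhds).and (self_mem_nhdsWithin (s := {z}ᶜ) (a := z))).exists
    exact hwz (hinjO hwO hz hw)
  let G : ℂ → ℂ := Function.invFunOn Φ O
  have hGΦ : ∀ z ∈ O, G (Φ z) = z := fun z hz => hinjO.leftInvOn_invFunOn hz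
  have himg : ∀ᶠ w in 𝓝 (Φ z₀), w ∈ Φ '' O :=
    hopen z₀ hz₀ (Filter.image_mem_map (hO.mem_nhds hz₀))
  have hcont : ∀ w ∈ Φ '' O, ContinuousAt G w := by
    rintro _ ⟨z, hz, rfl⟩
    rw [ContinuousAt, hGΦ z hz]
    intro N hN
    have hmem := hopen z hz (Filter.image_mem_map (m := Φ) (inter_mem hN (hO.mem_nhds hz)))
    refine Filter.mem_map.2 (mem_of_superset hmem ?_)
    rintro _ ⟨y, ⟨hyN, hyO⟩, rfl⟩
    change G (Φ y) ∈ N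
    rwa [hGΦ y hyO]
  have hinv : ∀ᶠ w in 𝓝 (Φ z₀), Φ (G w) = w := by
    filter_upwards [himg] with w hw
    obtain ⟨z, hz, rfl⟩ := hw
    rw [hGΦ z hz]
  have hΦ' : AnalyticAt ℂ Φ (G (Φ z₀)) := by rwa [hGΦ z₀ hz₀]
  have hGan := analyticAt_of_comp_eq hΦ' (himg.mono hcont) hinv
  have := deriv_mul_deriv_of_comp_eq hΦ' hGan hinv
  rw [hGΦ z₀ hz₀] at this
  exact left_ne_zero_of_mul_eq_one this

end LocalInverse

section Critical

open Polynomial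

/-- The Wronskian `p' q - p q'` of coprime polynomials, not both of degree at most one, has a zero:
if it were constant, `p'' q = p q''` would force `p'' = q'' = 0`. -/
theorem exists_root_wronskian {p q : ℂ[X]} (hpq : IsCoprime p q)
    (hd : 2 ≤ max p.natDegree q.natDegree) :
    ∃ z, (derivative p).eval z * q.eval z - p.eval z * (derivative q).eval z = 0 := by
  set w := derivative p * q - p * derivative q with hw
  have key : ∀ {s t : ℂ[X]}, IsCoprime s t →
      derivative (derivative s) * t = s * derivative (derivative t) → s.natDegree ≤ 1 := by
    intro s t hst h
    have hdvd : s ∣ derivative (derivative s) :=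
      hst.dvd_of_dvd_mul_right ⟨derivative (derivative t), h⟩
    by_contra! hs
    have h1 := natDegree_derivative_lt (p := s) (by omega)
    have h2 : (derivative (derivative s)).natDegree ≤ (derivative s).natDegree :=
      (natDegree_derivative_le _).trans (Nat.sub_le _ _)
    have h3 := eq_zero_of_dvd_of_natDegree_lt hdvd (by omega)
    have h4 := derivative_eq_zero.1 h3
    have h5 : (derivative s).natDegree = s.natDegree - 1 := natDegree_derivative s
    omega
  rcases lt_or_ge 0 w.degree with h | h
  · obtain ⟨z, hz⟩ := Complex.exists_root h
    exact ⟨z, by simpa [hw] using hz⟩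
  · exfalso
    have h1 : derivative w = 0 := by rw [eq_C_of_degree_le_zero h, derivative_C]
    have h2 : derivative (derivative p) * q = p * derivative (derivative q) := by
      have h3 : derivative w =
          derivative (derivative p) * q - p * derivative (derivative q) := by
        rw [hw, derivative_sub, derivative_mul, derivative_mul]; ring
      rw [h3] at h1
      exact sub_eq_zero.1 h1
    have h3 := key hpq h2
    have h4 := key hpq.symm (by rw [mul_comm, ← h2, mul_comm])
    omega

/-- A zero of the Wronskian is a zero of the derivative of `p / q` or of `q / p`. -/
theorem IsRationalMap.exists_isCriticalPt {f : OnePoint ℂ → OnePoint ℂ} {d : ℕ}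
    (hf : IsRationalMap f d) (hd : 2 ≤ d) : ∃ z : ℂ, IsCriticalPt f (z : OnePoint ℂ) := by
  obtain ⟨p, q, hpq, rfl, rfl⟩ := hf
  obtain ⟨z, hz⟩ := exists_root_wronskian hpq hd
  refine ⟨z, fun W hW hinj => ?_⟩
  have key : ∀ (s t : ℂ[X]), t.eval z ≠ 0 →
      (derivative s).eval z * t.eval z - s.eval z * (derivative t).eval z = 0 →
      (∀ a b, t.eval a ≠ 0 → t.eval b ≠ 0 → s.eval a / t.eval a = s.eval b / t.eval b →
        ratEval p q a = ratEval p q b) → False := by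
    intro s t ht hst hcong
    have hder : HasDerivAt (fun w => s.eval w / t.eval w) 0 z := by
      have := (s.hasDerivAt z).fun_div (t.hasDerivAt z) ht
      rwa [hst, zero_div] at this
    have han : AnalyticAt ℂ (fun w => s.eval w / t.eval w) z :=
      (AnalyticOnNhd.eval_polynomial s z trivial).fun_div
        (AnalyticOnNhd.eval_polynomial t z trivial) ht
    have hS : ((↑) ⁻¹' W ∩ {w : ℂ | t.eval w ≠ 0}) ∈ 𝓝 z :=
      inter_mem (OnePoint.continuous_coe.continuousAt.preimage_mem_nhds hW)
        (t.continuous.continuousAt.eventually_ne ht)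
    refine deriv_ne_zero_of_injOn han hS (fun a ha b hb hab => ?_) hder.deriv
    exact OnePoint.coe_injective (hinj ha.1 hb.1 (hcong a b ha.2 hb.2 hab))
  by_cases hq : q.eval z = 0
  · have hp : p.eval z ≠ 0 := by
      intro hp
      obtain ⟨a, b, hab⟩ := hpq
      have := congrArg (Polynomial.eval z) hab
      simp [hp, hq] at this
    refine key q p hp (by linear_combination -hz) fun a b ha hb hab => ?_
    change ratio (p.eval a) (q.eval a) = ratio (p.eval b) (q.eval b)
    rw [← sphereInv_ratio (Or.inr ha), ← sphereInv_ratio (Or.inr hb), ratio_of_ne_zero _ ha,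
      ratio_of_ne_zero _ hb, hab]
  · refine key p q hq hz fun a b ha hb hab => ?_
    change ratio (p.eval a) (q.eval a) = ratio (p.eval b) (q.eval b)
    rw [ratio_of_ne_zero _ ha, ratio_of_ne_zero _ hb, hab]

end Critical

/-! ### Normality and the Julia set -/

section Normality

variable {f : OnePoint ℂ → OnePoint ℂ} {d : ℕ}

/-- For continuous maps into a compact Hausdorff space, locally uniform convergence on an open set
is the same as continuous convergence; this rids normality of the uniform structure. -/
theorem iterNormalOn_iff (hf : Continuous f) {U : Set (OnePoint ℂ)} (hU : IsOpen U) :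
    IterNormalOn f U ↔ ∀ s : ℕ → ℕ, ∃ k : ℕ → ℕ, StrictMono k ∧ ∃ g : OnePoint ℂ → OnePoint ℂ,
      ∀ x ∈ U, Tendsto (fun p : ℕ × OnePoint ℂ => f^[s (k p.1)] p.2) (atTop ×ˢ 𝓝 x)
        (𝓝 (g x)) := by
  let _ : UniformSpace (OnePoint ℂ) := uniformSpaceOfCompactR1
  unfold IterNormalOn
  refine forall_congr' fun s => exists_congr fun k => and_congr_right fun _ =>
    exists_congr fun g => ?_
  rw [hU.tendstoLocallyUniformlyOn_iff_forall_tendsto]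
  constructor
  · intro h x hx
    have hcont : ContinuousOn g U := by
      refine TendstoLocallyUniformlyOn.continuousOn (F := fun n => f^[s (k n)]) (p := atTop)
        (hU.tendstoLocallyUniformlyOn_iff_forall_tendsto.2 h) ?_
      exact (Eventually.of_forall fun n => (hf.iterate _).continuousOn).frequently
    have h1 : Tendsto (fun p : ℕ × OnePoint ℂ => g p.2) (atTop ×ˢ 𝓝 x) (𝓝 (g x)) :=
      (hcont.continuousAt (hU.mem_nhds hx)).tendsto.comp tendsto_snd
    exact h1.congr_uniformity (h x hx)
  · intro h x hx
    have h1 : Tendsto g (𝓝 x) (𝓝 (g x)) := by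
      intro N hN
      obtain ⟨V, hV, hVc, hVN⟩ := exists_mem_nhds_isClosed_subset hN
      have h2 : ∀ᶠ y in 𝓝 x, ∀ᶠ n in atTop, f^[s (k n)] y ∈ V := by
        have h3 := (h x hx).comp (f := Prod.swap) (x := 𝓝 x ×ˢ atTop) tendsto_prod_swap
        exact (h3.eventually hV).curry
      rw [Filter.mem_map]
      filter_upwards [h2, hU.mem_nhds hx] with y hy hyU
      have h3 : Tendsto (fun n => f^[s (k n)] y) atTop (𝓝 (g y)) :=
        (h y hyU).comp (tendsto_id.prodMk tendsto_const_nhds)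
      exact hVN (hVc.mem_of_tendsto h3 hy)
    have h2 : Tendsto (fun p : ℕ × OnePoint ℂ => (g p.2, f^[s (k p.1)] p.2)) (atTop ×ˢ 𝓝 x)
        (𝓝 (g x, g x)) := (h1.comp tendsto_snd).prodMk_nhds (h x hx)
    exact h2.mono_right (nhds_le_uniformity (g x))

theorem mem_fatouSet {x : OnePoint ℂ} :
    x ∈ fatouSet f ↔ ∃ U, IsOpen U ∧ IterNormalOn f U ∧ x ∈ U := by
  simp [fatouSet, and_assoc]

theorem isOpen_fatouSet : IsOpen (fatouSet f) := isOpen_sUnion fun _ h => h.1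

theorem isClosed_juliaSet : IsClosed (juliaSet f) := isOpen_fatouSet.isClosed_compl

theorem mem_fatouSet_of_map (hf : IsRationalMap f d) {x : OnePoint ℂ} (hx : f x ∈ fatouSet f) :
    x ∈ fatouSet f := by
  obtain ⟨V, hV, hnorm, hxV⟩ := mem_fatouSet.1 hx
  rw [iterNormalOn_iff hf.continuous hV] at hnorm
  have hU : IsOpen (f ⁻¹' V) := hV.preimage hf.continuous
  refine mem_fatouSet.2 ⟨f ⁻¹' V, hU, (iterNormalOn_iff hf.continuous hU).2 fun s => ?_, hxV⟩
  by_cases hs : ∃ᶠ n in atTop, s n = 0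
  · obtain ⟨k, hk, hk0⟩ := extraction_of_frequently_atTop hs
    refine ⟨k, hk, id, fun y _ => ?_⟩
    simp only [hk0, Function.iterate_zero, id]
    exact tendsto_snd
  · rw [not_frequently, eventually_atTop] at hs
    obtain ⟨n₀, hn₀⟩ := hs
    obtain ⟨k, hk, g, hg⟩ := hnorm fun n => s (n + n₀) - 1
    refine ⟨fun n => k n + n₀, fun a b hab => Nat.add_lt_add_right (hk hab) n₀, g ∘ f,
      fun y hy => ?_⟩
    have h1 := (hg (f y) hy).comp
      ((tendsto_id (x := atTop)).prodMap (hf.continuous.tendsto y))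
    refine h1.congr fun p => ?_
    have h2 : s (k p.1 + n₀) ≠ 0 := hn₀ _ (Nat.le_add_left _ _)
    simp only [Function.comp_apply, Prod.map_fst, Prod.map_snd, id]
    rw [← Function.iterate_succ_apply, Nat.succ_eq_add_one, Nat.sub_add_cancel (by omega)]

/-- Forward invariance of the Fatou set: `f` is open, so limits of iterates on `U` descend to
limits on `f '' U`. -/
theorem map_mem_fatouSet (hf : IsRationalMap f d) (hd : d ≠ 0) {x : OnePoint ℂ}
    (hx : x ∈ fatouSet f) : f x ∈ fatouSet f := by
  obtain ⟨U, hU, hnorm, hxU⟩ := mem_fatouSet.1 hx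
  rw [iterNormalOn_iff hf.continuous hU] at hnorm
  have hV : IsOpen (f '' U) := hf.isOpenMap hd U hU
  refine mem_fatouSet.2 ⟨f '' U, hV, (iterNormalOn_iff hf.continuous hV).2 fun s => ?_,
    Set.mem_image_of_mem f hxU⟩
  obtain ⟨k, hk, g, hg⟩ := hnorm fun n => s n + 1
  have hpt : ∀ u ∈ U, Tendsto (fun n => f^[s (k n)] (f u)) atTop (𝓝 (g u)) := fun u hu =>
    (hg u hu).comp (tendsto_id.prodMk tendsto_const_nhds)
  refine ⟨k, hk, fun y => g (Function.invFunOn f U y), ?_⟩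
  rintro _ ⟨u, hu, rfl⟩
  have hmem : f u ∈ f '' U := Set.mem_image_of_mem f hu
  -- the limit does not depend on the chosen preimage
  have heq : g (Function.invFunOn f U (f u)) = g u := by
    have h1 := hpt _ (Function.invFunOn_mem hmem)
    rw [Function.invFunOn_eq hmem] at h1
    exact tendsto_nhds_unique h1 (hpt u hu)
  change Tendsto _ _ (𝓝 (g (Function.invFunOn f U (f u))))
  rw [heq]
  have h2 : 𝓝 (f u) = map f (𝓝 u) :=
    le_antisymm ((hf.isOpenMap hd).nhds_le u) hf.continuous.continuousAt
  rw [h2, prod_map_right, tendsto_map'_iff]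
  exact hg u hu

theorem iterate_mem_fatouSet_iff (hf : IsRationalMap f d) (hd : d ≠ 0) (n : ℕ) {x : OnePoint ℂ} :
    f^[n] x ∈ fatouSet f ↔ x ∈ fatouSet f := by
  induction n with
  | zero => rfl
  | succ n ih =>
    rw [Function.iterate_succ_apply', ← ih]
    exact ⟨mem_fatouSet_of_map hf, map_mem_fatouSet hf hd⟩

/-- Complete invariance of the Julia set. -/
theorem iterate_mem_juliaSet_iff (hf : IsRationalMap f d) (hd : d ≠ 0) (n : ℕ) {x : OnePoint ℂ} :
    f^[n] x ∈ juliaSet f ↔ x ∈ juliaSet f :=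
  not_congr (iterate_mem_fatouSet_iff hf hd n)

end Normality

section Moebius

/-- The coordinate `1 / (z - a)` on the complement of `a` in the sphere, with value `0` at infinity
(and the irrelevant value `0` at `a`). -/
noncomputable def invSub (a : ℂ) (x : OnePoint ℂ) : ℂ := x.elim 0 fun z => (z - a)⁻¹

/-- The inverse `w ↦ a + 1 / w` of the coordinate `invSub a`. -/
noncomputable def invSubSymm (a w : ℂ) : OnePoint ℂ := ratio (a * w + 1) w

@[simp] theorem invSub_coe (a z : ℂ) : invSub a (z : OnePoint ℂ) = (z - a)⁻¹ := rfl

theorem invSub_infty (a : ℂ) : invSub a (∞ : OnePoint ℂ) = 0 := rfl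

theorem invSub_ratio (a : ℂ) (u v : ℂ) : invSub a (ratio u v) = v / (u - a * v) := by
  by_cases hv : v = 0
  · rw [hv, ratio_zero_right, zero_div, invSub_infty]
  · rw [ratio_of_ne_zero _ hv, invSub_coe]
    have : u - a * v = (u / v - a) * v := by field_simp
    rw [this, mul_comm, div_mul_eq_div_div, div_self hv, one_div]

theorem invSubSymm_invSub {a : ℂ} {x : OnePoint ℂ} (hx : x ≠ (a : OnePoint ℂ)) :
    invSubSymm a (invSub a x) = x := by
  induction x using OnePoint.rec with
  | infty => simp [invSub_infty, invSubSymm]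
  | coe z =>
    have hz : z - a ≠ 0 := sub_ne_zero.2 fun h => hx (by rw [h])
    rw [invSubSymm, invSub_coe, ratio_of_ne_zero _ (inv_ne_zero hz)]
    congr 1
    field_simp
    ring

theorem sphAt_invSubSymm (a w : ℂ) : SphAt (invSubSymm a) w := by
  refine ⟨fun w => a * w + 1, id, by fun_prop, analyticAt_id, ?_, Eventually.of_forall fun w => rfl⟩
  by_cases hw : w = 0
  · left; simp [hw]
  · right; exact hw

theorem SphAt.analyticAt_invSub {h : ℂ → OnePoint ℂ} {z a : ℂ} (hh : SphAt h z)
    (hz : h z ≠ (a : OnePoint ℂ)) : AnalyticAt ℂ (fun w => invSub a (h w)) z := by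
  obtain ⟨u, v, hu, hv, h0, he⟩ := hh
  have hne : u z - a * v z ≠ 0 := by
    intro h1
    have h2 : u z = a * v z := sub_eq_zero.1 h1
    have h3 : v z ≠ 0 := fun hv0 => h0.elim (fun hu0 => hu0 (by rw [h2, hv0, mul_zero]))
      fun hv1 => hv1 hv0
    apply hz
    rw [he.self_of_nhds, ratio_of_ne_zero _ h3, h2, mul_div_cancel_right₀ _ h3]
  refine (hv.fun_div (hu.fun_sub (analyticAt_const.fun_mul hv)) hne).congr ?_
  filter_upwards [he] with w hw
  rw [hw, invSub_ratio]

theorem continuousAt_invSub {a : ℂ} {x : OnePoint ℂ} (hx : x ≠ (a : OnePoint ℂ)) :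
    ContinuousAt (invSub a) x := by
  induction x using OnePoint.rec with
  | infty =>
    have h1 := ((sphAt_sphereInv_coe 0).analyticAt_invSub (a := a) (by simp)).continuousAt
    have h2 : sphereInv ((0 : ℂ) : OnePoint ℂ) = (∞ : OnePoint ℂ) := by simp
    rw [ContinuousAt, h2] at h1
    rw [ContinuousAt, ← map_sphereInv_coe_nhds_zero, tendsto_map'_iff]
    exact h1
  | coe z =>
    rw [OnePoint.continuousAt_coe]
    exact ((sphAt_coe z).analyticAt_invSub hx).continuousAt

theorem norm_invSub_le {a : ℂ} {ρ : ℝ} (hρ : 0 < ρ) {x : OnePoint ℂ}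
    (hx : x ∉ ((↑) : ℂ → OnePoint ℂ) '' Metric.ball a ρ) : ‖invSub a x‖ ≤ ρ⁻¹ := by
  induction x using OnePoint.rec with
  | infty => rw [invSub_infty, norm_zero]; positivity
  | coe z =>
    have hz : ρ ≤ ‖z - a‖ := by
      by_contra! h
      exact hx ⟨z, by rwa [Metric.mem_ball, dist_eq_norm], rfl⟩
    rw [invSub_coe, norm_inv]
    exact inv_anti₀ hρ hz

end Moebius

section Montel

/-- Sequences of uniformly bounded, uniformly Lipschitz functions on a compact set have
subsequences that converge continuously on the interior (Arzelà-Ascoli). -/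
theorem exists_subseq_tendsto_of_lipschitzOn {S : Set ℂ} (hS : IsCompact S) {G : ℕ → ℂ → ℂ}
    {K : NNReal} (hK : ∀ n, LipschitzOnWith K (G n) S) {R : ℝ} (hR : ∀ n, ∀ z ∈ S, ‖G n z‖ ≤ R) :
    ∃ k : ℕ → ℕ, StrictMono k ∧ ∃ g : ℂ → ℂ, ∀ z ∈ interior S,
      Tendsto (fun p : ℕ × ℂ => G (k p.1) p.2) (atTop ×ˢ 𝓝 z) (𝓝 (g z)) := by
  have : CompactSpace S := isCompact_iff_compactSpace.1 hS
  let F : ℕ → BoundedContinuousFunction S ℂ := fun n =>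
    BoundedContinuousFunction.mkOfCompact ⟨S.domRestrict (G n), (hK n).to_restrict.continuous⟩
  have hFapp : ∀ n (z : S), F n z = G n z := fun n z => rfl
  have hcomp : IsCompact {h : BoundedContinuousFunction S ℂ |
      LipschitzWith K h ∧ ∀ x, ‖h x‖ ≤ R} := by
    refine BoundedContinuousFunction.arzela_ascoli₂ (Metric.closedBall 0 R)
      (isCompact_closedBall _ _) _ ?_ (fun h x hh => by simpa using hh.2 x) ?_
    · have h1 : IsClosed {h : BoundedContinuousFunction S ℂ | ∀ x, ‖h x‖ ≤ R} := by
        rw [Set.ofPred_forall]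
        exact isClosed_iInter fun x => isClosed_le (by fun_prop) continuous_const
      have h2 : IsClosed {h : BoundedContinuousFunction S ℂ | LipschitzWith K h} := by
        have : {h : BoundedContinuousFunction S ℂ | LipschitzWith K h} =
            ⋂ x, ⋂ y, {h : BoundedContinuousFunction S ℂ | dist (h x) (h y) ≤ K * dist x y} := by
          ext h; simp [lipschitzWith_iff_dist_le_mul]
        rw [this]
        exact isClosed_iInter fun x => isClosed_iInter fun y =>
          isClosed_le (by fun_prop) continuous_const
      exact h2.inter h1
    · exact (LipschitzWith.uniformEquicontinuous _ K fun h => h.2.1).equicontinuous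
  obtain ⟨h, -, k, hk, hlim⟩ := hcomp.tendsto_subseq (x := F)
    (fun n => ⟨(hK n).to_restrict, fun z => hR n z z.2⟩)
  classical
  refine ⟨k, hk, fun z => if hz : z ∈ S then h ⟨z, hz⟩ else 0, fun z hz => ?_⟩
  have hzS : z ∈ S := interior_subset hz
  simp only [hzS, dif_pos]
  refine Metric.tendsto_nhds.2 fun ε hε => ?_
  have h1 : ∀ᶠ n in atTop, dist (F (k n)) h < ε / 2 :=
    Metric.tendsto_nhds.1 hlim (ε / 2) (by positivity)
  have h2 : ∀ᶠ w in 𝓝 z, w ∈ S ∧ ∀ hw : w ∈ S, dist (h ⟨w, hw⟩) (h ⟨z, hzS⟩) < ε / 2 := by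
    have h3 : ∀ᶠ w : S in 𝓝 ⟨z, hzS⟩, dist (h w) (h ⟨z, hzS⟩) < ε / 2 :=
      Metric.tendsto_nhds.1 (h.continuous.tendsto ⟨z, hzS⟩) (ε / 2) (by positivity)
    rw [nhds_subtype_eq_comap, eventually_comap] at h3
    filter_upwards [h3, mem_interior_iff_mem_nhds.1 hz] with w hw hwS
    exact ⟨hwS, fun hw' => hw ⟨w, hw'⟩ rfl⟩
  filter_upwards [h1.prod_mk h2] with p hp
  have h4 := (BoundedContinuousFunction.dist_coe_le_dist (f := F (k p.1)) (g := h)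
    ⟨p.2, hp.2.1⟩).trans_lt hp.1
  have h5 := hp.2.2 hp.2.1
  calc dist (G (k p.1) p.2) (h ⟨z, hzS⟩)
      ≤ dist (F (k p.1) ⟨p.2, hp.2.1⟩) (h ⟨p.2, hp.2.1⟩) +
        dist (h ⟨p.2, hp.2.1⟩) (h ⟨z, hzS⟩) := dist_triangle _ _ _
    _ < ε := by linarith

/-- Schwarz's lemma for a function with bounded norm. -/
theorem dist_le_of_norm_le {G : ℂ → ℂ} {x : ℂ} {r R : ℝ}
    (hG : DifferentiableOn ℂ G (Metric.ball x r))
    (hR : ∀ z ∈ Metric.ball x r, ‖G z‖ ≤ R) {z : ℂ} (hz : z ∈ Metric.ball x r) :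
    dist (G z) (G x) ≤ 2 * R / r * dist z x := by
  have hr : 0 < r := dist_nonneg.trans_lt hz
  refine Complex.dist_le_div_mul_dist_of_mapsTo_ball hG (fun w hw => ?_) hz
  rw [Metric.mem_closedBall, dist_eq_norm]
  refine (norm_sub_le _ _).trans ?_
  linarith [hR w hw, hR x (Metric.mem_ball_self hr)]

theorem lipschitzOnWith_of_norm_le {G : ℂ → ℂ} {x : ℂ} {r R : ℝ} (hr : 0 < r)
    (hG : DifferentiableOn ℂ G (Metric.ball x r)) (hR : ∀ z ∈ Metric.ball x r, ‖G z‖ ≤ R) :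
    LipschitzOnWith (Real.toNNReal (2 * R / (r / 2))) G (Metric.closedBall x (r / 2)) := by
  have hR0 : 0 ≤ R := (norm_nonneg _).trans (hR x (Metric.mem_ball_self hr))
  refine LipschitzOnWith.of_dist_le_mul fun z hz w hw => ?_
  rw [Real.coe_toNNReal _ (by positivity)]
  rw [Metric.mem_closedBall] at hz hw
  have hsub : Metric.ball w (r / 2) ⊆ Metric.ball x r := Metric.ball_subset_ball' (by linarith)
  have hz' : z ∈ Metric.ball x r := by rw [Metric.mem_ball]; linarith
  have hw' : w ∈ Metric.ball x r := by rw [Metric.mem_ball]; linarith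
  rcases lt_or_ge (dist z w) (r / 2) with h | h
  · exact dist_le_of_norm_le (hG.mono hsub) (fun y hy => hR y (hsub hy)) h
  · have h1 : dist (G z) (G w) ≤ 2 * R := by
      rw [dist_eq_norm]
      refine (norm_sub_le _ _).trans ?_
      linarith [hR z hz', hR w hw']
    refine h1.trans ?_
    rw [div_mul_eq_mul_div, le_div_iff₀ (by positivity)]
    exact mul_le_mul_of_nonneg_left h (by positivity)

variable {f : OnePoint ℂ → OnePoint ℂ} {d : ℕ}

/-- Montel's theorem in the form needed here: if the iterates of `f` omit a fixed disc on a
neighbourhood of `x`, then `x` lies in the Fatou set. -/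
theorem mem_fatouSet_of_omits (hf : IsRationalMap f d) {x a : ℂ} {δ ρ : ℝ} (hδ : 0 < δ)
    (hρ : 0 < ρ) (homit : ∀ n, ∀ z ∈ Metric.ball x δ,
      f^[n] (z : OnePoint ℂ) ∉ ((↑) : ℂ → OnePoint ℂ) '' Metric.ball a ρ) :
    (x : OnePoint ℂ) ∈ fatouSet f := by
  have hne : ∀ n, ∀ z ∈ Metric.ball x δ, f^[n] (z : OnePoint ℂ) ≠ (a : OnePoint ℂ) :=
    fun n z hz h => homit n z hz ⟨a, Metric.mem_ball_self hρ, h.symm⟩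
  let G : ℕ → ℂ → ℂ := fun n z => invSub a (f^[n] (z : OnePoint ℂ))
  have hGd : ∀ n, DifferentiableOn ℂ (G n) (Metric.ball x δ) := fun n z hz =>
    (((sphAt_coe z).iterate hf n).analyticAt_invSub
      (hne n z hz)).differentiableAt.differentiableWithinAt
  have hGR : ∀ n, ∀ z ∈ Metric.ball x δ, ‖G n z‖ ≤ ρ⁻¹ := fun n z hz =>
    norm_invSub_le hρ (homit n z hz)
  have hlip := fun n => lipschitzOnWith_of_norm_le hδ (hGd n) (hGR n)
  have hsub : Metric.closedBall x (δ / 2) ⊆ Metric.ball x δ :=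
    Metric.closedBall_subset_ball (by linarith)
  have hU : IsOpen (((↑) : ℂ → OnePoint ℂ) '' Metric.ball x (δ / 2)) :=
    OnePoint.isOpenMap_coe _ Metric.isOpen_ball
  refine mem_fatouSet.2 ⟨_, hU, (iterNormalOn_iff hf.continuous hU).2 fun s => ?_,
    ⟨x, Metric.mem_ball_self (by positivity), rfl⟩⟩
  obtain ⟨k, hk, g, hg⟩ := exists_subseq_tendsto_of_lipschitzOn (isCompact_closedBall x (δ / 2))
    (fun n => hlip (s n)) (fun n z hz => hGR (s n) z (hsub hz))
  refine ⟨k, hk, fun y => invSubSymm a (g (toPlane y)), ?_⟩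
  rintro _ ⟨z, hz, rfl⟩
  have hint : z ∈ interior (Metric.closedBall x (δ / 2)) :=
    Metric.ball_subset_interior_closedBall hz
  rw [OnePoint.nhds_coe_eq, prod_map_right, tendsto_map'_iff]
  change Tendsto _ _ (𝓝 (invSubSymm a (g z)))
  refine ((sphAt_invSubSymm a (g z)).continuousAt.tendsto.comp (hg z hint)).congr' ?_
  have h1 : ∀ᶠ w in 𝓝 z, w ∈ Metric.ball x (δ / 2) := Metric.isOpen_ball.mem_nhds hz
  filter_upwards [h1.prod_inr atTop] with p hp
  exact invSubSymm_invSub (hne _ _ (Metric.ball_subset_ball (by linarith) hp))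

end Montel

/-! ### Attracting cycles and a trap for the critical points -/

section Attracting

variable {f : OnePoint ℂ → OnePoint ℂ} {d : ℕ}

/-- If, in the chart `e`, the iterate `f^m` is a contraction `F` to `z₀` of a disc, then that
disc lies in the Fatou set. -/
theorem image_ball_subset_fatouSet (hf : IsRationalMap f d) {m : ℕ} (hm : 0 < m)
    {e : ℂ → OnePoint ℂ} (he : Continuous e) (heo : IsOpenMap e) {F : ℂ → ℂ} {z₀ : ℂ} {l δ : ℝ}
    (hl0 : 0 ≤ l) (hl : l < 1)
    (hF : ∀ z ∈ Metric.ball z₀ δ, f^[m] (e z) = e (F z) ∧ dist (F z) z₀ ≤ l * dist z z₀) :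
    e '' Metric.ball z₀ δ ⊆ fatouSet f := by
  have hmaps : Set.MapsTo F (Metric.ball z₀ δ) (Metric.ball z₀ δ) := fun z hz =>
    lt_of_le_of_lt ((hF z hz).2.trans (mul_le_of_le_one_left dist_nonneg hl.le)) hz
  have hit : ∀ t : ℕ, ∀ z ∈ Metric.ball z₀ δ, f^[m * t] (e z) = e (F^[t] z) := by
    intro t z hz
    induction t with
    | zero => simp
    | succ t ih =>
      rw [Nat.mul_succ, add_comm, Function.iterate_add_apply, ih, Function.iterate_succ_apply',
        (hF _ (hmaps.iterate t hz)).1]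
  have hdist : ∀ t : ℕ, ∀ z ∈ Metric.ball z₀ δ, dist (F^[t] z) z₀ ≤ l ^ t * δ := by
    intro t z hz
    induction t with
    | zero => simpa using (Metric.mem_ball.1 hz).le
    | succ t ih =>
      rw [Function.iterate_succ_apply', pow_succ', mul_assoc]
      exact (hF _ (hmaps.iterate t hz)).2.trans (mul_le_mul_of_nonneg_left ih hl0)
  have hU : IsOpen (e '' Metric.ball z₀ δ) := heo _ Metric.isOpen_ball
  intro x hx
  refine mem_fatouSet.2 ⟨_, hU, (iterNormalOn_iff hf.continuous hU).2 fun s => ?_, hx⟩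
  by_cases hs : ∃ c, ∃ᶠ n in atTop, s n = c
  · obtain ⟨c, hc⟩ := hs
    obtain ⟨k, hk, hkc⟩ := extraction_of_frequently_atTop hc
    refine ⟨k, hk, f^[c], fun y _ => ?_⟩
    simp only [hkc]
    exact ((hf.continuous.iterate c).tendsto y).comp tendsto_snd
  · push Not at hs
    have hs_top : Tendsto s atTop atTop := by
      refine tendsto_atTop.2 fun b => ?_
      have h1 : ∀ᶠ n in atTop, ∀ c ∈ Finset.range b, s n ≠ c :=
        (Finset.eventually_all _).2 fun c _ => hs c
      filter_upwards [h1] with n hn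
      by_contra! hlt
      exact hn (s n) (Finset.mem_range.2 hlt) rfl
    -- some residue class modulo `m` occurs infinitely often
    obtain ⟨j, hj⟩ : ∃ j, ∃ᶠ n in atTop, s n % m = j := by
      by_contra! hcon
      have h1 : ∀ᶠ n in atTop, ∀ c ∈ Finset.range m, ¬ s n % m = c :=
        (Finset.eventually_all _).2 fun c _ => hcon c
      obtain ⟨n, hn⟩ := h1.exists
      exact hn _ (Finset.mem_range.2 (Nat.mod_lt _ hm)) rfl
    obtain ⟨k, hk, hkj⟩ := extraction_of_frequently_atTop hj
    refine ⟨k, hk, fun _ => f^[j] (e z₀), ?_⟩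
    rintro _ ⟨z, hz, rfl⟩
    have ht : Tendsto (fun n => s (k n) / m) atTop atTop :=
      (Nat.tendsto_div_const_atTop hm.ne').comp (hs_top.comp hk.tendsto_atTop)
    have h1 : Tendsto (fun p : ℕ × OnePoint ℂ => l ^ (s (k p.1) / m) * δ)
        (atTop ×ˢ 𝓝 (e z)) (𝓝 0) := by
      have := (((tendsto_pow_atTop_nhds_zero_of_lt_one hl0 hl).comp ht).mul_const δ)
      rw [zero_mul] at this
      exact this.comp tendsto_fst
    have hcont : Tendsto (fun w => f^[j] (e w)) (𝓝 z₀) (𝓝 (f^[j] (e z₀))) :=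
      ((hf.continuous.iterate j).comp he).tendsto z₀
    intro N hN
    obtain ⟨η, hη, hball⟩ := Metric.mem_nhds_iff.1 (hcont hN)
    rw [Filter.mem_map]
    have h2 : ∀ᶠ y in 𝓝 (e z), y ∈ e '' Metric.ball z₀ δ := hU.mem_nhds ⟨z, hz, rfl⟩
    filter_upwards [h1.eventually (gt_mem_nhds hη), h2.prod_inr atTop] with p hp1 hp2
    obtain ⟨w, hw, hwp⟩ := hp2
    change f^[s (k p.1)] p.2 ∈ N
    rw [← hwp, ← Nat.mod_add_div (s (k p.1)) m, hkj, Function.iterate_add_apply, hit _ w hw]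
    exact hball ((hdist _ w hw).trans_lt hp1)

/-- An attracting periodic point has a compact neighbourhood in the Fatou set which is mapped into
itself by the period. -/
theorem IsAttractingPeriodicPt.exists_nhds (hf : IsRationalMap f d) {x : OnePoint ℂ}
    (hx : IsAttractingPeriodicPt f x) :
    ∃ m, 0 < m ∧ f^[m] x = x ∧ ∃ B, IsCompact B ∧ B ∈ 𝓝 x ∧ Set.MapsTo f^[m] B B ∧
      B ⊆ fatouSet f := by
  obtain ⟨m, hm, hmx, hmul⟩ := hx
  -- the period read in a chart `e`
  obtain ⟨e, he, heo, F, z₀, hez, hFe, hF, hF₀, hF'⟩ : ∃ e : ℂ → OnePoint ℂ, Continuous e ∧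
      IsOpenMap e ∧ ∃ (F : ℂ → ℂ) (z₀ : ℂ), e z₀ = x ∧ (∀ᶠ z in 𝓝 z₀, f^[m] (e z) = e (F z)) ∧
        AnalyticAt ℂ F z₀ ∧ F z₀ = z₀ ∧ ‖deriv F z₀‖ < 1 := by
    induction x using OnePoint.rec with
    | infty =>
      have h0 : sphereInv ((0 : ℂ) : OnePoint ℂ) = (∞ : OnePoint ℂ) := by simp
      have hS : SphAt (fun z : ℂ => sphereInv (f^[m] (sphereInv (z : OnePoint ℂ)))) 0 :=
        ((sphAt_sphereInv_coe 0).iterate hf m).inv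
      have hval : sphereInv (f^[m] (sphereInv ((0 : ℂ) : OnePoint ℂ))) =
          ((0 : ℂ) : OnePoint ℂ) := by
        rw [h0, hmx, sphereInv_infty]
      obtain ⟨h1, h2⟩ := hS.exists_analyticAt (by rw [hval]; exact OnePoint.coe_ne_infty _)
      refine ⟨fun z => sphereInv (z : OnePoint ℂ),
        continuous_sphereInv.comp OnePoint.continuous_coe,
        sphereInvHomeo.isOpenMap.comp OnePoint.isOpenMap_coe, _, 0, h0, ?_, h1, ?_, hmul⟩
      · filter_upwards [h2] with z hz
        rw [← hz, sphereInv_sphereInv]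
      · rw [hval, toPlane_coe]
    | coe z =>
      obtain ⟨h1, h2⟩ := ((sphAt_coe z).iterate hf m).exists_analyticAt
        (by rw [hmx]; exact OnePoint.coe_ne_infty _)
      exact ⟨fun z => (z : OnePoint ℂ), OnePoint.continuous_coe, OnePoint.isOpenMap_coe, _, z, rfl,
        h2, h1, by rw [hmx, toPlane_coe], hmul⟩
  obtain ⟨l, hl, hl1⟩ := exists_between hF'
  have hl0 : 0 ≤ l := (norm_nonneg _).trans hl.le
  have hcontr : ∀ᶠ z in 𝓝 z₀, dist (F z) z₀ ≤ l * dist z z₀ := by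
    have h1 := hF.differentiableAt.hasDerivAt.isLittleO
    filter_upwards [h1.def (show 0 < l - ‖deriv F z₀‖ by linarith)] with z hz
    rw [hF₀] at hz
    rw [dist_eq_norm, dist_eq_norm]
    have h2 : F z - z₀ = (F z - z₀ - (z - z₀) • deriv F z₀) + (z - z₀) • deriv F z₀ := by ring
    calc ‖F z - z₀‖ ≤ ‖F z - z₀ - (z - z₀) • deriv F z₀‖ + ‖(z - z₀) • deriv F z₀‖ := by
          conv_lhs => rw [h2]
          exact norm_add_le _ _
      _ ≤ (l - ‖deriv F z₀‖) * ‖z - z₀‖ + ‖z - z₀‖ * ‖deriv F z₀‖ := by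
          rw [norm_smul]; linarith
      _ = l * ‖z - z₀‖ := by ring
  obtain ⟨δ, hδ, hball⟩ := Metric.eventually_nhds_iff_ball.1 (hFe.and hcontr)
  have hsub : Metric.closedBall z₀ (δ / 2) ⊆ Metric.ball z₀ δ :=
    Metric.closedBall_subset_ball (by linarith)
  refine ⟨m, hm, hmx, e '' Metric.closedBall z₀ (δ / 2), (isCompact_closedBall _ _).image he,
    ?_, ?_, ?_⟩
  · rw [← hez]
    exact heo.image_mem_nhds (Metric.closedBall_mem_nhds _ (by positivity))
  · rintro _ ⟨z, hz, rfl⟩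
    obtain ⟨h1, h2⟩ := hball z (hsub hz)
    refine ⟨F z, ?_, h1.symm⟩
    rw [Metric.mem_closedBall] at hz ⊢
    exact (h2.trans (mul_le_of_le_one_left dist_nonneg hl1.le)).trans hz
  · exact (Set.image_mono hsub).trans
      (image_ball_subset_fatouSet hf hm he heo hl0 hl1 hball)

/-- A point whose orbit converges to an attracting cycle has a closed forward invariant
neighbourhood in the Fatou set. -/
theorem exists_forward_invariant_nhds (hf : IsRationalMap f d) (hd : d ≠ 0) {c x : OnePoint ℂ}
    (hx : IsAttractingPeriodicPt f x)
    (hc : Tendsto (fun n : ℕ => f^[n] c) atTop (𝓝ˢ (Set.range fun k : ℕ => f^[k] x))) :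
    ∃ A, IsClosed A ∧ Set.MapsTo f A A ∧ A ⊆ fatouSet f ∧ A ∈ 𝓝 c := by
  obtain ⟨m, hm, hmx, B, hB, hBx, hmaps, hBF⟩ := hx.exists_nhds hf
  set A₀ := ⋃ j ∈ Finset.range m, f^[j] '' B with hA₀
  have hA₀c : IsClosed A₀ :=
    isClosed_biUnion_finset fun j _ => (hB.image (hf.continuous.iterate j)).isClosed
  have hBA₀ : B ⊆ A₀ := fun y hy =>
    Set.mem_biUnion (Finset.mem_coe.2 (Finset.mem_range.2 hm)) ⟨y, hy, rfl⟩
  have hA₀f : Set.MapsTo f A₀ A₀ := by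
    intro y hy
    obtain ⟨j, hj, b, hb, rfl⟩ := Set.mem_iUnion₂.1 hy
    rw [← Function.iterate_succ_apply' f]
    rcases Nat.lt_or_ge (j + 1) m with h | h
    · exact Set.mem_biUnion (Finset.mem_coe.2 (Finset.mem_range.2 h)) ⟨b, hb, rfl⟩
    · have : j + 1 = m := le_antisymm (Nat.succ_le_of_lt (Finset.mem_range.1 hj)) h
      rw [Nat.succ_eq_add_one, this]
      exact hBA₀ (hmaps hb)
  have hA₀F : A₀ ⊆ fatouSet f := by
    intro y hy
    obtain ⟨j, -, b, hb, rfl⟩ := Set.mem_iUnion₂.1 hy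
    exact (iterate_mem_fatouSet_iff hf hd j).2 (hBF hb)
  -- the points that reach the interior of `B` form a neighbourhood of the whole cycle
  have hV : IsOpen (⋃ j : ℕ, f^[j] ⁻¹' interior B) :=
    isOpen_iUnion fun j => isOpen_interior.preimage (hf.continuous.iterate j)
  have hrange : (Set.range fun k : ℕ => f^[k] x) ⊆ ⋃ j : ℕ, f^[j] ⁻¹' interior B := by
    rintro _ ⟨k, rfl⟩
    refine Set.mem_iUnion.2 ⟨m * k - k, ?_⟩
    have hk : k ≤ m * k := Nat.le_mul_of_pos_left k hm
    change f^[m * k - k] (f^[k] x) ∈ interior B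
    rw [← Function.iterate_add_apply, Nat.sub_add_cancel hk, Function.iterate_mul,
      Function.iterate_fixed hmx]
    exact mem_interior_iff_mem_nhds.2 hBx
  obtain ⟨n, hn⟩ := (hc.eventually (hV.mem_nhdsSet.2 hrange)).exists
  obtain ⟨j, hj⟩ := Set.mem_iUnion.1 hn
  have hcB : f^[j + n] c ∈ interior B := by rw [Function.iterate_add_apply]; exact hj
  refine ⟨f^[j + n] ⁻¹' A₀, hA₀c.preimage (hf.continuous.iterate _), fun y hy => ?_, fun y hy => ?_,
    ?_⟩
  · change f^[j + n] (f y) ∈ A₀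
    rw [← Function.iterate_succ_apply, Function.iterate_succ_apply']
    exact hA₀f hy
  · exact (iterate_mem_fatouSet_iff hf hd _).1 (hA₀F hy)
  · exact (hf.continuous.iterate _).continuousAt.preimage_mem_nhds
      (mem_of_superset (mem_interior_iff_mem_nhds.1 hcB) hBA₀)

theorem isClosed_criticalPts : IsClosed {c | IsCriticalPt f c} := by
  refine isOpen_compl_iff.1 (isOpen_iff_mem_nhds.2 fun c hc => ?_)
  have hc' : ¬ ∀ W ∈ 𝓝 c, ¬ Set.InjOn f W := hc
  push Not at hc'
  obtain ⟨W, hW, hinj⟩ := hc'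
  filter_upwards [eventually_mem_nhds_iff.2 hW] with y hy hcrit
  exact hcrit W hy hinj

/-- The Fatou set of a hyperbolic map has a closed forward invariant subset which is a neighbourhood
of all critical points; finitely many of the sets of `exists_forward_invariant_nhds` suffice, as the
set of critical points is compact. -/
theorem IsHyperbolic.exists_trap (hf : IsRationalMap f d) (hd : d ≠ 0) (hyp : IsHyperbolic f) :
    ∃ A, IsClosed A ∧ Set.MapsTo f A A ∧ A ⊆ fatouSet f ∧ ∀ c, IsCriticalPt f c → A ∈ 𝓝 c := by
  have key : ∃ A, IsClosed A ∧ Set.MapsTo f A A ∧ A ⊆ fatouSet f ∧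
      {c | IsCriticalPt f c} ⊆ interior A := by
    refine isClosed_criticalPts.isCompact.induction_on
      (p := fun S => ∃ A, IsClosed A ∧ Set.MapsTo f A A ∧ A ⊆ fatouSet f ∧ S ⊆ interior A)
      ⟨∅, isClosed_empty, Set.mapsTo_empty _ _, Set.empty_subset _, Set.empty_subset _⟩ ?_ ?_ ?_
    · rintro s t hst ⟨A, h1, h2, h3, h4⟩
      exact ⟨A, h1, h2, h3, hst.trans h4⟩
    · rintro s t ⟨A, h1, h2, h3, h4⟩ ⟨A', h1', h2', h3', h4'⟩
      exact ⟨A ∪ A', h1.union h1', h2.union_union h2', Set.union_subset h3 h3',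
        Set.union_subset (h4.trans (interior_mono Set.subset_union_left))
          (h4'.trans (interior_mono Set.subset_union_right))⟩
    · intro c hc
      obtain ⟨x, hx, hlim⟩ := hyp c hc
      obtain ⟨A, h1, h2, h3, h4⟩ := exists_forward_invariant_nhds hf hd hx hlim
      exact ⟨interior A, mem_nhdsWithin_of_mem_nhds (interior_mem_nhds.2 h4),
        A, h1, h2, h3, subset_rfl⟩
  obtain ⟨A, h1, h2, h3, h4⟩ := key
  exact ⟨A, h1, h2, h3, fun c hc => mem_interior_iff_mem_nhds.1 (h4 hc)⟩

end Attracting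

/-! ### Inverse branches -/

section Branches

variable {f : OnePoint ℂ → OnePoint ℂ} {d : ℕ} {A : Set (OnePoint ℂ)}

/-- `g` is a continuous inverse branch of `fⁿ` over the disc `ball x r`. -/
structure IsBranch (f : OnePoint ℂ → OnePoint ℂ) (n : ℕ) (x : ℂ) (r : ℝ) (g : ℂ → OnePoint ℂ) :
    Prop where
  continuousOn : ContinuousOn g (Metric.ball x r)
  map_eq : ∀ w ∈ Metric.ball x r, f^[n] (g w) = (w : OnePoint ℂ)

/-- Away from a closed forward invariant set containing the critical points, the iterates are
covering maps. -/
theorem isCoveringMapOn_iterate (hf : IsRationalMap f d) (hd : d ≠ 0)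
    (hAf : Set.MapsTo f A A) (hAc : ∀ c, IsCriticalPt f c → c ∈ A) (n : ℕ) :
    IsCoveringMapOn f^[n] Aᶜ := by
  have hinj : ∀ n (y : OnePoint ℂ), f^[n] y ∉ A → ∃ W ∈ 𝓝 y, Set.InjOn f^[n] W := by
    intro n
    induction n with
    | zero => exact fun y _ => ⟨Set.univ, univ_mem, Function.injective_id.injOn⟩
    | succ n ih =>
      intro y hy
      have hyA : y ∉ A := fun h => hy (hAf.iterate (n + 1) h)
      have hy' : ¬ ∀ W ∈ 𝓝 y, ¬ Set.InjOn f W := fun h => hyA (hAc y h)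
      push Not at hy'
      obtain ⟨W, hW, hWinj⟩ := hy'
      obtain ⟨W', hW', hWinj'⟩ := ih (f y) hy
      refine ⟨W ∩ f ⁻¹' W', inter_mem hW (hf.continuous.continuousAt.preimage_mem_nhds hW'), ?_⟩
      exact hWinj'.comp (hWinj.mono Set.inter_subset_left) fun z hz => hz.2
  have hopen : IsOpenMap f^[n] := by
    clear hinj
    induction n with
    | zero => exact IsOpenMap.id
    | succ n ih => exact ih.comp (hf.isOpenMap hd)
  refine IsCoveringMapOn.of_isLocalHomeomorphOn (hf.continuous.iterate n) ?_
  rw [isLocalHomeomorphOn_iff_isOpenEmbedding_restrict]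
  intro y hy
  obtain ⟨W, hW, hWinj⟩ := hinj n y hy
  obtain ⟨V, hVW, hV, hyV⟩ := mem_nhds_iff.1 hW
  refine ⟨V, hV.mem_nhds hyV, ?_⟩
  exact .of_continuous_injective_isOpenMap
    ((hf.continuous.iterate n).comp continuous_subtype_val)
    (Set.injOn_iff_injective.1 (hWinj.mono hVW)) (hopen.domRestrict hV)

/-- Discs that miss `A` are simply connected, so their inclusion lifts uniquely along the covering
map `fⁿ`. -/
theorem existsUnique_lift (hf : IsRationalMap f d) (hd : d ≠ 0)
    (hAf : Set.MapsTo f A A) (hAc : ∀ c, IsCriticalPt f c → c ∈ A) {n : ℕ} {x : ℂ} {r : ℝ}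
    (hball : ∀ w ∈ Metric.ball x r, (w : OnePoint ℂ) ∉ A) (z : Metric.ball x r)
    {y : OnePoint ℂ} (hy : f^[n] y = ((z : ℂ) : OnePoint ℂ)) :
    ∃! F : C(Metric.ball x r, OnePoint ℂ), F z = y ∧ f^[n] ∘ F =
      fun w : Metric.ball x r => ((w : ℂ) : OnePoint ℂ) := by
  have : ContractibleSpace (Metric.ball x r) := (convex_ball x r).contractibleSpace ⟨z, z.2⟩
  have : LocallyPathConnectedSpace (Metric.ball x r) :=
    Metric.isOpen_ball.locallyPathConnectedSpace
  let ι : C(Metric.ball x r, OnePoint ℂ) :=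
    ⟨fun w => ((w : ℂ) : OnePoint ℂ), OnePoint.continuous_coe.comp continuous_subtype_val⟩
  exact (isCoveringMapOn_iterate hf hd hAf hAc n).existsUnique_continuousMap_lifts ι hy
    fun w => hball w w.2

theorem exists_branch (hf : IsRationalMap f d) (hd : d ≠ 0)
    (hAf : Set.MapsTo f A A) (hAc : ∀ c, IsCriticalPt f c → c ∈ A) {n : ℕ} {x : ℂ} {r : ℝ}
    (hball : ∀ w ∈ Metric.ball x r, (w : OnePoint ℂ) ∉ A) {z : ℂ} (hz : z ∈ Metric.ball x r)
    {y : OnePoint ℂ} (hy : f^[n] y = (z : OnePoint ℂ)) : ∃ g, IsBranch f n x r g ∧ g z = y := by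
  obtain ⟨F, ⟨hFz, hFf⟩, -⟩ := existsUnique_lift hf hd hAf hAc hball ⟨z, hz⟩ hy
  classical
  refine ⟨fun w => if hw : w ∈ Metric.ball x r then F ⟨w, hw⟩ else y, ⟨?_, fun w hw => ?_⟩, ?_⟩
  · rw [continuousOn_iff_continuous_domRestrict]
    refine F.continuous.congr fun w => ?_
    simp only [Set.domRestrict_apply, dif_pos w.2]
  · rw [dif_pos hw]
    exact congrFun hFf ⟨w, hw⟩
  · exact (dif_pos hz).trans hFz

theorem IsBranch.eqOn (hf : IsRationalMap f d) (hd : d ≠ 0)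
    (hAf : Set.MapsTo f A A) (hAc : ∀ c, IsCriticalPt f c → c ∈ A) {n : ℕ} {x : ℂ} {r : ℝ}
    (hball : ∀ w ∈ Metric.ball x r, (w : OnePoint ℂ) ∉ A) {g g' : ℂ → OnePoint ℂ}
    (hg : IsBranch f n x r g) (hg' : IsBranch f n x r g') {z : ℂ} (hz : z ∈ Metric.ball x r)
    (h : g z = g' z) : Set.EqOn g g' (Metric.ball x r) := by
  have huniq := (existsUnique_lift hf hd hAf hAc hball ⟨z, hz⟩ (hg.map_eq z hz)).unique
    (y₁ := ⟨_, continuousOn_iff_continuous_domRestrict.1 hg.continuousOn⟩)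
    (y₂ := ⟨_, continuousOn_iff_continuous_domRestrict.1 hg'.continuousOn⟩)
    ⟨rfl, funext fun w => hg.map_eq w w.2⟩ ⟨h.symm, funext fun w => hg'.map_eq w w.2⟩
  exact fun w hw => DFunLike.congr_fun huniq ⟨w, hw⟩

theorem IsBranch.notMem (hAf : Set.MapsTo f A A) {n : ℕ} {x : ℂ} {r : ℝ}
    (hball : ∀ w ∈ Metric.ball x r, (w : OnePoint ℂ) ∉ A) {g : ℂ → OnePoint ℂ}
    (hg : IsBranch f n x r g) {w : ℂ} (hw : w ∈ Metric.ball x r) : g w ∉ A := fun h =>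
  hball w hw (by rw [← hg.map_eq w hw]; exact hAf.iterate n h)

/-- In the coordinate `1 / (z - a)`, with `a` in the trap, inverse branches are analytic. -/
theorem IsBranch.analyticAt_invSub (hf : IsRationalMap f d) {n : ℕ} {x a : ℂ} {r : ℝ}
    {g : ℂ → OnePoint ℂ} (hg : IsBranch f n x r g)
    (hga : ∀ w ∈ Metric.ball x r, g w ≠ (a : OnePoint ℂ)) {w₀ : ℂ} (hw₀ : w₀ ∈ Metric.ball x r) :
    AnalyticAt ℂ (fun w => invSub a (g w)) w₀ := by
  have hnear : ∀ᶠ w in 𝓝 w₀, w ∈ Metric.ball x r := Metric.isOpen_ball.mem_nhds hw₀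
  have hval : ∀ w ∈ Metric.ball x r,
      f^[n] (invSubSymm a (invSub a (g w))) = (w : OnePoint ℂ) := fun w hw => by
    rw [invSubSymm_invSub (hga w hw), hg.map_eq w hw]
  have hΦ := (((sphAt_invSubSymm a (invSub a (g w₀))).iterate hf n).exists_analyticAt
    (by rw [hval w₀ hw₀]; exact OnePoint.coe_ne_infty _)).1
  refine analyticAt_of_comp_eq hΦ ?_ ?_
  · filter_upwards [hnear] with w hw
    exact (continuousAt_invSub (hga w hw)).comp
      (hg.continuousOn.continuousAt (Metric.isOpen_ball.mem_nhds hw))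
  · filter_upwards [hnear] with w hw
    rw [hval w hw, toPlane_coe]

end Branches

/-! ### Contraction of inverse branches -/

section Quantitative

/-- Second order Taylor estimate for a bounded analytic function, by Schwarz's lemma applied to the
difference quotient. -/
theorem norm_sub_sub_deriv_le {G : ℂ → ℂ} {x : ℂ} {r R : ℝ}
    (hG : DifferentiableOn ℂ G (Metric.ball x r)) (hR : ∀ z ∈ Metric.ball x r, ‖G z‖ ≤ R) {z : ℂ}
    (hz : z ∈ Metric.ball x r) :
    ‖G z - G x - (z - x) * deriv G x‖ ≤ 4 * R / r ^ 2 * ‖z - x‖ ^ 2 := by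
  have hr : 0 < r := dist_nonneg.trans_lt hz
  have hd : DifferentiableOn ℂ (dslope G x) (Metric.ball x r) :=
    (Complex.differentiableOn_dslope (Metric.ball_mem_nhds x hr)).2 hG
  have hb : ∀ w ∈ Metric.ball x r, ‖dslope G x w‖ ≤ 2 * R / r := fun w hw =>
    Complex.norm_dslope_le_div_of_mapsTo_ball hG (fun y hy => by
      rw [Metric.mem_closedBall, dist_eq_norm]
      refine (norm_sub_le _ _).trans ?_
      linarith [hR y hy, hR x (Metric.mem_ball_self hr)]) hw
  have h1 := dist_le_of_norm_le hd hb hz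
  rw [dist_eq_norm, dist_eq_norm, dslope_same] at h1
  have h2 : G z - G x - (z - x) * deriv G x = (z - x) * (dslope G x z - deriv G x) := by
    have := sub_smul_dslope G x z
    rw [smul_eq_mul] at this
    rw [mul_sub, this]
  rw [h2, norm_mul]
  calc ‖z - x‖ * ‖dslope G x z - deriv G x‖ ≤ ‖z - x‖ * (2 * (2 * R / r) / r * ‖z - x‖) :=
        mul_le_mul_of_nonneg_left h1 (norm_nonneg _)
    _ = _ := by field_simp; ring

/-- The image of a disc under a bounded analytic function contains a disc whose radius depends only
on the bound, the radius, and a lower bound for the derivative at the centre. -/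
theorem exists_ball_subset_image {r R c : ℝ} (hr : 0 < r) (hR : 0 < R) (hc : 0 < c) :
    ∃ ρ > 0, ∀ (G : ℂ → ℂ) (x : ℂ), DifferentiableOn ℂ G (Metric.ball x r) →
      (∀ z ∈ Metric.ball x r, ‖G z‖ ≤ R) → c ≤ ‖deriv G x‖ →
      Metric.ball (G x) ρ ⊆ G '' Metric.ball x r := by
  set K := 4 * R / r ^ 2 with hK
  have hKpos : 0 < K := by positivity
  set s := min (r / 2) (c / (2 * K)) with hs
  have hs0 : 0 < s := lt_min (by positivity) (by positivity)
  have hsr : s < r := (min_le_left _ _).trans_lt (by linarith)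
  have hsK : K * s ≤ c / 2 := by
    have := min_le_right (r / 2) (c / (2 * K))
    rw [← hs, le_div_iff₀ (by positivity)] at this
    linarith
  refine ⟨c * s / 2 / 2, by positivity, fun G x hG hGR hder => ?_⟩
  have hsub : Metric.closedBall x s ⊆ Metric.ball x r := Metric.closedBall_subset_ball hsr
  have hdx : DifferentiableAt ℂ G x :=
    hG.differentiableAt (Metric.ball_mem_nhds x hr)
  refine (DiffContOnCl.ball_subset_image_closedBall ?_ hs0 (fun z hz => ?_) ?_).trans
    (Set.image_mono hsub)
  · refine DifferentiableOn.diffContOnCl ?_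
    rw [closure_ball x hs0.ne']
    exact hG.mono hsub
  · have hz' : ‖z - x‖ = s := by rwa [mem_sphere_iff_norm] at hz
    have h1 := norm_sub_sub_deriv_le hG hGR (hsub (Metric.sphere_subset_closedBall hz))
    rw [← hK, hz'] at h1
    have h2 : ‖(z - x) * deriv G x‖ - ‖G z - G x‖ ≤ ‖G z - G x - (z - x) * deriv G x‖ := by
      rw [norm_sub_rev (G z - G x)]
      exact norm_sub_norm_le _ _
    rw [norm_mul, hz'] at h2
    have h3 := mul_le_mul_of_nonneg_left hder hs0.le
    have h4 := mul_le_mul_of_nonneg_right hsK hs0.le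
    nlinarith
  · have hne : deriv G x ≠ 0 := fun h => by rw [h, norm_zero] at hder; linarith
    have h1 := hdx.hasDerivAt.eventually_ne (c := G x) hne
    exact (h1.frequently).filter_mono nhdsWithin_le_nhds

end Quantitative

section Contraction

variable {f : OnePoint ℂ → OnePoint ℂ} {d : ℕ}

/-- A forward invariant set `A` that contains the critical points and the disc `ball a ρ`, and
keeps distance `r` from the Julia set. -/
structure IsTrap (f : OnePoint ℂ → OnePoint ℂ) (A : Set (OnePoint ℂ)) (a : ℂ) (ρ r : ℝ) :
    Prop where
  mapsTo : Set.MapsTo f A A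
  critical_mem : ∀ c, IsCriticalPt f c → c ∈ A
  ρ_pos : 0 < ρ
  r_pos : 0 < r
  ball_subset : ((↑) : ℂ → OnePoint ℂ) '' Metric.ball a ρ ⊆ A
  notMem : ∀ x ∈ planeJulia f, ∀ w ∈ Metric.ball x r, (w : OnePoint ℂ) ∉ A

theorem coe_image_planeJulia (hJ : (∞ : OnePoint ℂ) ∉ juliaSet f) :
    ((↑) : ℂ → OnePoint ℂ) '' planeJulia f = juliaSet f := by
  ext x
  constructor
  · rintro ⟨z, hz, rfl⟩
    exact hz
  · intro hx
    have hx' : x ≠ (∞ : OnePoint ℂ) := fun h => hJ (h ▸ hx)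
    exact ⟨toPlane x, by rw [planeJulia, Set.mem_ofPred_eq, coe_toPlane hx']; exact hx,
      coe_toPlane hx'⟩

theorem isCompact_planeJulia (hJ : (∞ : OnePoint ℂ) ∉ juliaSet f) : IsCompact (planeJulia f) := by
  rw [OnePoint.isOpenEmbedding_coe.isInducing.isCompact_iff, coe_image_planeJulia hJ]
  exact isClosed_juliaSet.isCompact

theorem toPlane_mem_planeJulia (hJ : (∞ : OnePoint ℂ) ∉ juliaSet f) {x : OnePoint ℂ}
    (hx : x ∈ juliaSet f) : toPlane x ∈ planeJulia f ∧ (toPlane x : OnePoint ℂ) = x := by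
  have hx' : x ≠ (∞ : OnePoint ℂ) := fun h => hJ (h ▸ hx)
  have := coe_toPlane hx'
  exact ⟨by rw [planeJulia, Set.mem_ofPred_eq, this]; exact hx, this⟩

/-- The centre `a` of the disc in the trap is a critical point; the distance `r` to the trap is
positive by compactness of the Julia set. -/
theorem IsHyperbolic.exists_isTrap (hf : IsRationalMap f d) (hd : 2 ≤ d) (hyp : IsHyperbolic f)
    (hJ : (∞ : OnePoint ℂ) ∉ juliaSet f) : ∃ A a ρ r, IsTrap f A a ρ r := by
  obtain ⟨A, hA, hAf, hAF, hAc⟩ := hyp.exists_trap hf (by omega)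
  obtain ⟨a, ha⟩ := hf.exists_isCriticalPt hd
  have ha' : ∀ᶠ z : ℂ in 𝓝 a, (z : OnePoint ℂ) ∈ A :=
    OnePoint.continuous_coe.continuousAt.eventually (hAc _ ha)
  obtain ⟨ρ, hρ, hball⟩ := Metric.eventually_nhds_iff_ball.1 ha'
  have hopen : IsOpen {z : ℂ | (z : OnePoint ℂ) ∉ A} :=
    hA.isOpen_compl.preimage OnePoint.continuous_coe
  obtain ⟨r, hr, hthick⟩ := (isCompact_planeJulia hJ).exists_thickening_subset_open hopen
    fun z hz hzA => hz (hAF hzA)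
  refine ⟨A, a, ρ, r, hAf, fun c hc => mem_of_mem_nhds (hAc c hc), hρ, hr, ?_, fun x hx w hw => ?_⟩
  · rintro _ ⟨z, hz, rfl⟩
    exact hball z hz
  · exact hthick (Metric.mem_thickening_iff.2 ⟨x, hx, hw⟩)

namespace IsTrap

variable {A : Set (OnePoint ℂ)} {a : ℂ} {ρ r : ℝ}

theorem center_mem (hA : IsTrap f A a ρ r) : (a : OnePoint ℂ) ∈ A :=
  hA.ball_subset ⟨a, Metric.mem_ball_self hA.ρ_pos, rfl⟩

theorem ne_center (hA : IsTrap f A a ρ r) {x : OnePoint ℂ} (hx : x ∉ A) : x ≠ (a : OnePoint ℂ) :=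
  fun h => hx (h ▸ hA.center_mem)

theorem branch_notMem (hA : IsTrap f A a ρ r) {n : ℕ} {x : ℂ} (hx : x ∈ planeJulia f)
    {g : ℂ → OnePoint ℂ} (hg : IsBranch f n x r g) {w : ℂ} (hw : w ∈ Metric.ball x r) : g w ∉ A :=
  hg.notMem hA.mapsTo (hA.notMem x hx) hw

theorem differentiableOn_invSub (hA : IsTrap f A a ρ r) (hf : IsRationalMap f d) {n : ℕ} {x : ℂ}
    (hx : x ∈ planeJulia f) {g : ℂ → OnePoint ℂ} (hg : IsBranch f n x r g) :
    DifferentiableOn ℂ (fun w => invSub a (g w)) (Metric.ball x r) := fun _ hw =>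
  (hg.analyticAt_invSub hf (fun _ hw => hA.ne_center (hA.branch_notMem hx hg hw))
    hw).differentiableAt.differentiableWithinAt

theorem norm_invSub_le (hA : IsTrap f A a ρ r) {n : ℕ} {x : ℂ} (hx : x ∈ planeJulia f)
    {g : ℂ → OnePoint ℂ} (hg : IsBranch f n x r g) {w : ℂ} (hw : w ∈ Metric.ball x r) :
    ‖invSub a (g w)‖ ≤ ρ⁻¹ :=
  HypJulia.norm_invSub_le hA.ρ_pos fun h => hA.branch_notMem hx hg hw (hA.ball_subset h)

/-- The derivatives of the inverse branches of `fⁿ` tend to zero uniformly on the Julia set.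
Otherwise the images of these branches contain a fixed disc around a point `y` of the Julia set, for
infinitely many `n`; no iterate of `f` maps a point of this disc into the trap, so that `y` is in
the Fatou set by Montel's theorem. -/
theorem exists_norm_deriv_lt (hA : IsTrap f A a ρ r) (hf : IsRationalMap f d) (hd : d ≠ 0)
    (hJ : (∞ : OnePoint ℂ) ∉ juliaSet f) {c : ℝ} (hc : 0 < c) :
    ∃ N, ∀ n, N ≤ n → ∀ x ∈ planeJulia f, ∀ g, IsBranch f n x r g →
      ‖deriv (fun w => invSub a (g w)) x‖ < c := by
  by_contra! hcon
  choose n hn x hx g hg hder using hcon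
  obtain ⟨ρ', hρ', himg⟩ := exists_ball_subset_image hA.r_pos (inv_pos.2 hA.ρ_pos) hc
  have hxr : ∀ N, x N ∈ Metric.ball (x N) r := fun N => Metric.mem_ball_self hA.r_pos
  have hgJ : ∀ N, g N (x N) ∈ juliaSet f := fun N => by
    rw [← iterate_mem_juliaSet_iff hf hd (n N), (hg N).map_eq _ (hxr N)]
    exact hx N
  obtain ⟨y, hy, k, hk, hlim⟩ := (isCompact_planeJulia hJ).tendsto_subseq
    fun N => (toPlane_mem_planeJulia hJ (hgJ N)).1
  refine hy ?_
  have hyA : (y : OnePoint ℂ) ∉ A := hA.notMem y hy y (Metric.mem_ball_self hA.r_pos)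
  have hcont : ContinuousAt (fun z : ℂ => invSub a (z : OnePoint ℂ)) y :=
    ContinuousAt.comp (f := fun z : ℂ => (z : OnePoint ℂ)) (continuousAt_invSub (hA.ne_center hyA))
      OnePoint.continuous_coe.continuousAt
  have hclose : ∀ᶠ z : ℂ in 𝓝 y,
      dist (invSub a (z : OnePoint ℂ)) (invSub a (y : OnePoint ℂ)) < ρ' / 2 :=
    Metric.tendsto_nhds.1 hcont _ (by positivity)
  have hya : ∀ᶠ z in 𝓝 y, z ≠ a := by
    refine isOpen_ne.mem_nhds fun h => ?_
    exact hA.ne_center hyA (by rw [h])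
  obtain ⟨δ, hδ, hball⟩ := Metric.eventually_nhds_iff_ball.1 (hclose.and hya)
  refine mem_fatouSet_of_omits hf (a := a) hδ hA.ρ_pos fun j z hz hmem => ?_
  -- a later branch covers `z`, so a point of `A` on the orbit of `z` would be carried by forward
  -- invariance to a point of a disc about the Julia set that misses `A`
  obtain ⟨N, hN1, hN2⟩ := ((hlim.eventually hclose).and (eventually_ge_atTop j)).exists
  rw [Function.comp_apply, (toPlane_mem_planeJulia hJ (hgJ _)).2] at hN1
  have hz' : invSub a (z : OnePoint ℂ) ∈ Metric.ball (invSub a (g (k N) (x (k N)))) ρ' := by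
    have h1 := (hball z hz).1
    rw [dist_comm] at hN1
    rw [Metric.mem_ball]
    linarith [dist_triangle (invSub a (z : OnePoint ℂ)) (invSub a (y : OnePoint ℂ))
      (invSub a (g (k N) (x (k N))))]
  obtain ⟨w, hw, hwz⟩ := himg _ _ (hA.differentiableOn_invSub hf (hx _) (hg _))
    (fun z hz => hA.norm_invSub_le (hx _) (hg _) hz) (hder _) hz'
  replace hwz : invSub a (g (k N) w) = invSub a (z : OnePoint ℂ) := hwz
  have hgw := hA.branch_notMem (hx _) (hg _) hw
  have hzw : (z : OnePoint ℂ) = g (k N) w := by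
    rw [← invSubSymm_invSub (hA.ne_center hgw), hwz,
      invSubSymm_invSub fun h => (hball z hz).2 (OnePoint.coe_injective h)]
  refine hA.notMem _ (hx (k N)) w hw ?_
  rw [← (hg (k N)).map_eq w hw, ← hzw]
  have hle : j ≤ n (k N) := hN2.trans ((hk.id_le N).trans (hn _))
  rw [← Nat.sub_add_cancel hle, Function.iterate_add_apply]
  exact hA.mapsTo.iterate _ (hA.ball_subset hmem)

/-- Inverse branches over discs centred on the Julia set are uniformly Lipschitz at the centre, and
contract by a factor of two for high iterates. -/
theorem exists_contraction (hA : IsTrap f A a ρ r) (hf : IsRationalMap f d) (hd : d ≠ 0)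
    (hJ : (∞ : OnePoint ℂ) ∉ juliaSet f) :
    ∃ r₀ > 0, r₀ ≤ r ∧ ∃ C : ℝ, 0 ≤ C ∧ ∃ N, ∀ n, ∀ x ∈ planeJulia f, ∀ g, IsBranch f n x r g →
      ∀ z ∈ Metric.ball x r₀, dist (toPlane (g z)) (toPlane (g x)) ≤ C * dist z x ∧
        (N ≤ n → dist (toPlane (g z)) (toPlane (g x)) ≤ 1 / 2 * dist z x) := by
  obtain ⟨M, hM⟩ := (isCompact_planeJulia hJ).isBounded.subset_closedBall a
  have hr := hA.r_pos
  have hρ := hA.ρ_pos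
  -- the estimates are made in the bounded coordinate `1 / (z - a)` and carried back to the plane;
  -- `2 κ` bounds the coordinate `1 / (z - a)` from below on the Julia set
  set κ : ℝ := 1 / (2 * max M 1) with hκ
  have hM1 : 0 < max M 1 := lt_max_of_lt_right one_pos
  have hκ0 : 0 < κ := by positivity
  set R := ρ⁻¹ with hR
  have hR0 : 0 < R := inv_pos.2 hρ
  obtain ⟨N, hN⟩ := hA.exists_norm_deriv_lt hf hd hJ (c := κ ^ 2 / 2) (by positivity)
  set K := 4 * R / r ^ 2 with hK
  have hK0 : 0 < K := by positivity
  set r₀ := min r (min (κ / (2 * R / r)) (κ ^ 2 / 2 / K)) with hr₀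
  have h2R : 0 < 2 * R / r := by positivity
  refine ⟨r₀, lt_min hr (lt_min (by positivity) (by positivity)), min_le_left _ _,
    (2 * R / r) / (2 * κ ^ 2), by positivity, N, fun n x hx g hg z hz => ?_⟩
  have hxr : x ∈ Metric.ball x r := Metric.mem_ball_self hr
  have hzr : z ∈ Metric.ball x r := Metric.ball_subset_ball (min_le_left _ _) hz
  have hG := hA.differentiableOn_invSub hf hx hg
  have hGR : ∀ w ∈ Metric.ball x r, ‖invSub a (g w)‖ ≤ R := fun w hw => hA.norm_invSub_le hx hg hw
  have hzlt : dist z x < r₀ := hz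
  have hz1 : 2 * R / r * dist z x ≤ κ := by
    have := hzlt.le.trans ((min_le_right _ _).trans (min_le_left _ _))
    rwa [le_div_iff₀ h2R, mul_comm] at this
  have hz2 : K * dist z x ≤ κ ^ 2 / 2 := by
    have := hzlt.le.trans ((min_le_right _ _).trans (min_le_right _ _))
    rwa [le_div_iff₀ hK0, mul_comm] at this
  have hlip : dist (invSub a (g z)) (invSub a (g x)) ≤ 2 * R / r * dist z x :=
    dist_le_of_norm_le hG hGR hzr
  have hgJ : g x ∈ juliaSet f := by
    rw [← iterate_mem_juliaSet_iff hf hd n, hg.map_eq _ hxr]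
    exact hx
  obtain ⟨hyJ, hy⟩ := toPlane_mem_planeJulia hJ hgJ
  have hgx : 2 * κ ≤ ‖invSub a (g x)‖ := by
    have h1 : ‖toPlane (g x) - a‖ ≤ max M 1 := by
      rw [← dist_eq_norm]
      exact (hM hyJ).trans (le_max_left _ _)
    have h2 : toPlane (g x) - a ≠ 0 := by
      intro h
      refine hA.ne_center (hA.branch_notMem hx hg hxr) ?_
      rw [← hy, sub_eq_zero.1 h]
    rw [← hy, invSub_coe, norm_inv, hκ]
    have h3 : 2 * (1 / (2 * max M 1)) = (max M 1)⁻¹ := by field_simp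
    rw [h3]
    exact inv_anti₀ (norm_pos_iff.2 h2) h1
  have hgz : κ ≤ ‖invSub a (g z)‖ := by
    have h1 := norm_sub_norm_le (invSub a (g x)) (invSub a (g z))
    rw [← dist_eq_norm, dist_comm] at h1
    linarith
  have hform : ∀ w ∈ Metric.ball x r, invSub a (g w) ≠ 0 →
      toPlane (g w) = a + (invSub a (g w))⁻¹ := by
    intro w hw h0
    conv_lhs => rw [← invSubSymm_invSub (hA.ne_center (hA.branch_notMem hx hg hw))]
    rw [invSubSymm, ratio_of_ne_zero _ h0, toPlane_coe]
    field_simp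
  have hx0 : invSub a (g x) ≠ 0 := norm_pos_iff.1 (by linarith)
  have hz0 : invSub a (g z) ≠ 0 := norm_pos_iff.1 (by linarith)
  have hdist : dist (toPlane (g z)) (toPlane (g x)) ≤
      dist (invSub a (g z)) (invSub a (g x)) / (2 * κ ^ 2) := by
    rw [hform z hzr hz0, hform x hxr hx0, dist_add_left, dist_eq_norm, inv_sub_inv hz0 hx0,
      norm_div,
      norm_mul, dist_comm, dist_eq_norm]
    refine div_le_div_of_nonneg_left (norm_nonneg _) (by positivity) ?_
    calc 2 * κ ^ 2 = κ * (2 * κ) := by ring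
      _ ≤ _ := mul_le_mul hgz hgx (by positivity) (norm_nonneg _)
  refine ⟨hdist.trans ?_, fun hn => hdist.trans ?_⟩
  · rw [div_mul_eq_mul_div]
    exact div_le_div_of_nonneg_right hlip (by positivity)
  · have h1 := norm_sub_sub_deriv_le hG hGR hzr
    have h2 := hN n hn x hx g hg
    rw [← hK, ← dist_eq_norm z x] at h1
    have h3 : dist (invSub a (g z)) (invSub a (g x)) ≤ κ ^ 2 * dist z x := by
      rw [dist_eq_norm]
      calc ‖invSub a (g z) - invSub a (g x)‖
          = ‖(invSub a (g z) - invSub a (g x) - (z - x) * deriv (fun w => invSub a (g w)) x) +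
              (z - x) * deriv (fun w => invSub a (g w)) x‖ := by rw [sub_add_cancel]
        _ ≤ K * dist z x ^ 2 + dist z x * (κ ^ 2 / 2) := by
            refine (norm_add_le _ _).trans (add_le_add h1 ?_)
            rw [norm_mul, ← dist_eq_norm]
            exact mul_le_mul_of_nonneg_left h2.le dist_nonneg
        _ ≤ κ ^ 2 * dist z x := by
            have := mul_le_mul_of_nonneg_right hz2 (dist_nonneg (x := z) (y := x))
            nlinarith
    rw [div_le_iff₀ (by positivity)]
    linarith

/-- A nonempty closed backward invariant subset `E` of the Julia set is everything: if `x ∉ E` then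
the preimages of a small disc around a point of `E` stay near `E`, hence the iterates of `f` omit
that disc near `x`. -/
theorem planeJulia_subset (hA : IsTrap f A a ρ r) (hf : IsRationalMap f d) (hd : d ≠ 0)
    (hJ : (∞ : OnePoint ℂ) ∉ juliaSet f) {E : Set ℂ} (hE : IsClosed E) (hne : E.Nonempty)
    (hEJ : E ⊆ planeJulia f) (hback : ∀ y ∈ planeJulia f, planeMap f y ∈ E → y ∈ E) :
    planeJulia f ⊆ E := by
  obtain ⟨r₀, hr₀, hr₀r, C, hC, N, hcontr⟩ := hA.exists_contraction hf hd hJ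
  have hiter : ∀ n (y : OnePoint ℂ) (e : ℂ), e ∈ E → f^[n] y = (e : OnePoint ℂ) →
      ∃ e' ∈ E, y = (e' : OnePoint ℂ) := by
    intro n
    induction n with
    | zero => exact fun y e he h => ⟨e, he, h⟩
    | succ n ih =>
      intro y e he h
      obtain ⟨e', he', hfy⟩ := ih (f y) e he h
      have hyJ : y ∈ juliaSet f := by
        rw [← iterate_mem_juliaSet_iff hf hd 1, Function.iterate_one, hfy]
        exact hEJ he'
      obtain ⟨h1, h2⟩ := toPlane_mem_planeJulia hJ hyJ
      refine ⟨toPlane y, hback _ h1 ?_, h2.symm⟩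
      rw [planeMap, h2, hfy]
      exact he'
  intro x hx
  by_contra hxE
  obtain ⟨η, hη, hball⟩ := Metric.isOpen_iff.1 hE.isOpen_compl x hxE
  obtain ⟨e, he⟩ := hne
  set ρ₁ := min r₀ (η / 2 / (C + 1)) with hρ₁
  have hρ₁0 : 0 < ρ₁ := lt_min hr₀ (by positivity)
  refine hx (mem_fatouSet_of_omits hf (a := e) (δ := η / 2) (by positivity) hρ₁0 ?_)
  rintro n z hz ⟨w, hw, hwz⟩
  have hwr₀ : w ∈ Metric.ball e r₀ := Metric.ball_subset_ball (min_le_left _ _) hw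
  have hwr : w ∈ Metric.ball e r := Metric.ball_subset_ball hr₀r hwr₀
  obtain ⟨g, hg, hgw⟩ := exists_branch hf hd hA.mapsTo hA.critical_mem (hA.notMem e (hEJ he)) hwr
    hwz.symm
  obtain ⟨e', he', hge⟩ := hiter n (g e) e he (hg.map_eq e (Metric.mem_ball_self hA.r_pos))
  have h1 := (hcontr n e (hEJ he) g hg w hwr₀).1
  rw [hgw, hge, toPlane_coe, toPlane_coe] at h1
  have h2 : C * dist w e < η / 2 := by
    have h3 : dist w e < η / 2 / (C + 1) := lt_of_lt_of_le hw (min_le_right _ _)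
    rw [lt_div_iff₀ (by positivity)] at h3
    nlinarith [dist_nonneg (x := w) (y := e)]
  refine hball (?_ : e' ∈ Metric.ball x η) he'
  rw [Metric.mem_ball] at hz ⊢
  have h4 := dist_triangle e' z x
  rw [dist_comm e' z] at h4
  linarith

end IsTrap

end Contraction

/-! ### The dynamics on the Julia set -/

section JuliaSystem

variable {f : OnePoint ℂ → OnePoint ℂ} {d : ℕ}

theorem coe_planeMap (hf : IsRationalMap f d) (hd : d ≠ 0) (hJ : (∞ : OnePoint ℂ) ∉ juliaSet f)
    {x : ℂ} (hx : x ∈ planeJulia f) :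
    planeMap f x ∈ planeJulia f ∧ (planeMap f x : OnePoint ℂ) = f (x : OnePoint ℂ) :=
  toPlane_mem_planeJulia hJ ((iterate_mem_juliaSet_iff hf hd 1).2 hx)

theorem exists_lipschitzWith_restrict {E : Type*} [PseudoMetricSpace E] {J : Set ℂ}
    (hJ : IsCompact J) {ψ : ℂ → E}
    (h : ∀ x ∈ J, ∃ K : NNReal, ∃ t ∈ 𝓝 x, LipschitzOnWith K ψ t) :
    ∃ K : NNReal, LipschitzWith K fun x : J => ψ x := by
  obtain ⟨K, hK⟩ := LocallyLipschitzOn.exists_lipschitzOnWith_of_compact (f := ψ) hJ fun x hx => by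
    obtain ⟨K, t, ht, hKt⟩ := h x hx
    exact ⟨K, t, mem_nhdsWithin_of_mem_nhds ht, hKt⟩
  exact ⟨K, hK.to_restrict⟩

theorem exists_lipschitzWith_of_contDiffOn {J U : Set ℂ} (hJ : IsCompact J) (hU : IsOpen U)
    (hJU : J ⊆ U) {ψ : ℂ → ℝ} (hψ : ContDiffOn ℝ 1 ψ U) :
    ∃ K : NNReal, LipschitzWith K fun x : J => ψ x :=
  exists_lipschitzWith_restrict hJ fun _ hx =>
    (hψ.contDiffAt (hU.mem_nhds (hJU hx))).exists_lipschitzOnWith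

variable {T : planeJulia f → planeJulia f}

theorem coe_iterate (hT : ∀ x, ((T x : ℂ) : OnePoint ℂ) = f (x : ℂ)) (n : ℕ)
    (x : planeJulia f) : ((T^[n] x : ℂ) : OnePoint ℂ) = f^[n] (x : ℂ) := by
  induction n with
  | zero => rfl
  | succ n ih => rw [Function.iterate_succ_apply', Function.iterate_succ_apply', hT, ih]

theorem iterate_eq_iff (hT : ∀ x, ((T x : ℂ) : OnePoint ℂ) = f (x : ℂ)) (n : ℕ)
    (x y : planeJulia f) : T^[n] y = x ↔ f^[n] (y : ℂ) = ((x : ℂ) : OnePoint ℂ) := by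
  rw [← coe_iterate hT, OnePoint.coe_eq_coe, Subtype.ext_iff]

/-- A hyperbolic rational map restricts to an expanding system on its Julia set. -/
theorem isExpandingSystem_julia (hf : IsRationalMap f d) (hd : 2 ≤ d) (hyp : IsHyperbolic f)
    (hJ : (∞ : OnePoint ℂ) ∉ juliaSet f)
    (hT : ∀ x, ((T x : ℂ) : OnePoint ℂ) = f (x : ℂ)) : IsExpandingSystem T := by
  have hd0 : d ≠ 0 := by omega
  obtain ⟨A, a, ρ, r, hA⟩ := hyp.exists_isTrap hf hd hJ
  have hTplane : ∀ x, (T x : ℂ) = planeMap f x := fun x => by rw [planeMap, ← hT, toPlane_coe]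
  refine ⟨?_, fun x => ?_, ?_, fun E hE hne hback => ?_⟩
  · obtain ⟨K, hK⟩ := exists_lipschitzWith_restrict (ψ := planeMap f) (isCompact_planeJulia hJ)
      fun x hx => by
        have h1 := (((sphAt_coe x).rational hf).exists_analyticAt (by
          rw [← (coe_planeMap hf hd0 hJ hx).2]; exact OnePoint.coe_ne_infty _)).1
        exact (h1.contDiffAt (n := 1)).exists_lipschitzOnWith
    refine ⟨K, fun x y => ?_⟩
    have := hK x y
    simp only [← hTplane] at this
    exact this
  · refine ((hf.finite_fibre hd0 ((x : ℂ) : OnePoint ℂ)).preimage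
      (Subtype.val_injective.injOn)).subset fun y hy => ?_
    exact (iterate_eq_iff hT 1 x y).1 hy
  · obtain ⟨r₀, hr₀, hr₀r, C, hC, N, hcontr⟩ := hA.exists_contraction hf hd0 hJ
    refine ⟨r₀, hr₀, C, hC, N, fun n x z hxz => ?_⟩
    have hzr₀ : (z : ℂ) ∈ Metric.ball (x : ℂ) r₀ := by
      rw [Metric.mem_ball, dist_comm]; exact hxz
    have hzr : (z : ℂ) ∈ Metric.ball (x : ℂ) r := Metric.ball_subset_ball hr₀r hzr₀
    have hxr : (x : ℂ) ∈ Metric.ball (x : ℂ) r := Metric.mem_ball_self hA.r_pos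
    have hex : ∀ y : planeJulia f, T^[n] y = x → ∃ g, IsBranch f n x r g ∧
        g x = ((y : ℂ) : OnePoint ℂ) := fun y hy =>
      exists_branch hf hd0 hA.mapsTo hA.critical_mem (hA.notMem x x.2) hxr
        ((iterate_eq_iff hT n x y).1 hy)
    choose! g hg hgx using hex
    have hJmem : ∀ g', IsBranch f n x r g' → ∀ w : planeJulia f, (w : ℂ) ∈ Metric.ball (x : ℂ) r →
        g' w ∈ juliaSet f := fun g' hg' w hw => by
      rw [← iterate_mem_juliaSet_iff hf hd0 n, hg'.map_eq _ hw]
      exact w.2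
    have hτ : ∀ y : planeJulia f, ∃ y' : planeJulia f,
        T^[n] y = x → ((y' : ℂ) : OnePoint ℂ) = g y z := fun y => by
      by_cases hy : T^[n] y = x
      · obtain ⟨h1, h2⟩ := toPlane_mem_planeJulia hJ (hJmem _ (hg y hy) z hzr)
        exact ⟨⟨_, h1⟩, fun _ => h2⟩
      · exact ⟨y, fun h => absurd h hy⟩
    choose τ hτ using hτ
    refine ⟨τ, ⟨fun y hy => ?_, fun y hy y' hy' h => ?_, fun y' hy' => ?_⟩, fun y hy => ?_⟩
    · exact (iterate_eq_iff hT n z _).2 (by rw [hτ y hy, (hg y hy).map_eq _ hzr])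
    · have h1 : g y z = g y' z := by rw [← hτ y hy, ← hτ y' hy', h]
      have h2 := (hg y hy).eqOn hf hd0 hA.mapsTo hA.critical_mem (hA.notMem x x.2) (hg y' hy')
        hzr h1 hxr
      rw [hgx y hy, hgx y' hy'] at h2
      exact Subtype.ext (OnePoint.coe_injective h2)
    · obtain ⟨g', hg', hgz⟩ := exists_branch hf hd0 hA.mapsTo hA.critical_mem (hA.notMem x x.2) hzr
        ((iterate_eq_iff hT n z y').1 hy')
      obtain ⟨h1, h2⟩ := toPlane_mem_planeJulia hJ (hJmem g' hg' x hxr)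
      have hy : T^[n] ⟨_, h1⟩ = x := (iterate_eq_iff hT n x _).2 (by rw [h2, hg'.map_eq _ hxr])
      refine ⟨⟨_, h1⟩, hy, ?_⟩
      have h3 := (hg _ hy).eqOn hf hd0 hA.mapsTo hA.critical_mem (hA.notMem x x.2) hg' hxr
        (by rw [hgx _ hy, h2]) hzr
      refine Subtype.ext (OnePoint.coe_injective ?_)
      rw [hτ _ hy, h3, hgz]
    · have h1 := hcontr n x x.2 (g y) (hg y hy) z hzr₀
      rw [← hτ y hy, hgx y hy, toPlane_coe, toPlane_coe, dist_comm (z : ℂ)] at h1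
      exact h1
  · have hE' : IsClosed (Subtype.val '' E) :=
      (isCompact_planeJulia hJ).isClosed.isClosedEmbedding_subtypeVal.isClosedMap E hE
    have := hA.planeJulia_subset hf hd0 hJ hE' (hne.image _) (by simp) (fun y hy hyE => by
      obtain ⟨w, hw, hwy⟩ := hyE
      refine ⟨⟨y, hy⟩, hback ?_, rfl⟩
      have : T ⟨y, hy⟩ = w := Subtype.ext (by rw [hTplane, hwy])
      rw [Set.mem_preimage, this]
      exact hw)
    refine Set.eq_univ_of_forall fun x => ?_
    obtain ⟨y, hy, hyx⟩ := this x.2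
    rwa [← Subtype.ext hyx]

/-- On the Julia set the complex transfer operator is the real one of the restricted dynamics. -/
theorem transfer_eq_ofReal (hf : IsRationalMap f d) (hd : d ≠ 0)
    (hT : ∀ x, ((T x : ℂ) : OnePoint ℂ) = f (x : ℂ)) (hfin : ∀ x, {y | T y = x}.Finite) (φ : ℂ → ℝ)
    {H : ℂ → ℂ} {h : planeJulia f → ℝ} (hH : ∀ y : planeJulia f, H y = h y) (x : planeJulia f) :
    transfer f φ H x = (ruelle T (fun y => φ y) h x : ℂ) := by
  have hbij : Set.BijOn Subtype.val {y | T y = x}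
      {y : ℂ | f (y : OnePoint ℂ) = ((x : ℂ) : OnePoint ℂ)} := by
    refine ⟨fun y hy => (iterate_eq_iff hT 1 x y).1 hy, Subtype.val_injective.injOn,
      fun y hy => ?_⟩
    have hyJ : y ∈ planeJulia f := by
      refine (iterate_mem_juliaSet_iff hf hd 1).1 ?_
      rw [Function.iterate_one, hy]
      exact x.2
    exact ⟨⟨y, hyJ⟩, (iterate_eq_iff hT 1 x ⟨y, hyJ⟩).2 hy, rfl⟩
  rw [ruelle_eq_sum (hfin x), transfer,
    ← finsum_mem_eq_of_bijOn (f := fun y : planeJulia f => (Real.exp (φ y) : ℂ) * (h y : ℂ)) _ hbij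
      fun y _ => by rw [hH],
    finsum_mem_eq_finite_toFinset_sum _ (hfin x)]
  push_cast
  rfl

end JuliaSystem

end HypJulia

open HypJulia

theorem theorem2p9
    (f : OnePoint ℂ → OnePoint ℂ) (d : ℕ) (hd : 2 ≤ d)
    (hf : HypJulia.IsRationalMap f d) (hyp : HypJulia.IsHyperbolic f)
    (hJ : (∞ : OnePoint ℂ) ∉ HypJulia.juliaSet f)
    (U : Set ℂ) (hU : IsOpen U) (hJU : HypJulia.planeJulia f ⊆ U)
    (φ : ℂ → ℝ) (hφ : ContDiffOn ℝ 1 φ U)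
    (μ : Measure ℂ) (hμ : HypJulia.IsEquilibriumState f φ μ)
    (hnorm : HypJulia.IsNormalized f φ μ)
    (ψ : ℂ → ℝ) (hψ : ContDiffOn ℝ 1 ψ U)
    (ε : ℝ) (hε : 0 < ε) :
    ∃ C δ₀ : ℝ, 0 < C ∧ 0 < δ₀ ∧ ∀ n : ℕ, 1 ≤ n →
      μ.real {x | x ∈ HypJulia.planeJulia f ∧
        |birkhoffSum (HypJulia.planeMap f) ψ n x / n - ∫ y, ψ y ∂μ| > ε}
      ≤ C * Real.exp (-(n * δ₀)) := by
  have hd0 : d ≠ 0 := by omega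
  obtain ⟨hprob, hsupp, -⟩ := hμ.1
  have hJc := isCompact_planeJulia hJ
  have hJm : MeasurableSet (planeJulia f) := hJc.measurableSet
  have : CompactSpace (planeJulia f) := isCompact_iff_compactSpace.1 hJc
  let T : planeJulia f → planeJulia f := fun x => ⟨planeMap f x, (coe_planeMap hf hd0 hJ x.2).1⟩
  have hT : ∀ x, ((T x : ℂ) : OnePoint ℂ) = f (x : ℂ) := fun x => (coe_planeMap hf hd0 hJ x.2).2
  have hexp : IsExpandingSystem T := isExpandingSystem_julia hf hd hyp hJ hT
  obtain ⟨Kφ, hKφ⟩ := exists_lipschitzWith_of_contDiffOn hJc hU hJU hφ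
  obtain ⟨Kψ, hKψ⟩ := exists_lipschitzWith_of_contDiffOn hJc hU hJU hψ
  -- the measure, on the Julia set as a space
  let ν : Measure (planeJulia f) := μ.comap Subtype.val
  have hνapp : ∀ s, ν s = μ (Subtype.val '' s) := fun s =>
    (MeasurableEmbedding.subtype_coe hJm).comap_apply μ s
  have hμJ : μ.restrict (planeJulia f) = μ :=
    Measure.restrict_eq_self_of_ae_mem (mem_ae_iff.2 hsupp)
  have hνprob : IsProbabilityMeasure ν := by
    refine ⟨?_⟩
    rw [hνapp, Set.image_univ, Subtype.range_coe, ← Measure.restrict_apply_univ, hμJ]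
    exact measure_univ
  have hint : ∀ {E : Type} [NormedAddCommGroup E] [NormedSpace ℝ E] (h : ℂ → E),
      ∫ x, h x ∂μ = ∫ x : planeJulia f, h x ∂ν := fun h => by
    rw [integral_subtype_comap hJm, hμJ]
  have hone : ∀ x, ruelle T (fun y => φ y) (fun _ => 1) x = 1 := fun x => by
    have h1 := hnorm.transfer_one x x.2
    rw [transfer_eq_ofReal hf hd0 hT hexp.finite_fibre φ (h := fun _ => 1) (by simp)] at h1
    exact_mod_cast h1
  have hdual : ∀ h : C(planeJulia f, ℝ),
      ∫ x, ruelle T (fun y => φ y) h x ∂ν = ∫ x, h x ∂ν := by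
    classical
    intro h
    let H : ℂ → ℂ := fun z => if hz : z ∈ planeJulia f then (h ⟨z, hz⟩ : ℂ) else 0
    have hH : ∀ y : planeJulia f, H y = h y := fun y => dif_pos y.2
    have hHc : ContinuousOn H (planeJulia f) := by
      rw [continuousOn_iff_continuous_domRestrict]
      exact (Complex.continuous_ofReal.comp h.continuous).congr fun y => (hH y).symm
    have h1 := hnorm.dual_eq H hHc
    rw [hint, hint] at h1
    simp only [transfer_eq_ofReal hf hd0 hT hexp.finite_fibre φ hH, hH] at h1
    rw [integral_complex_ofReal, integral_complex_ofReal] at h1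
    exact_mod_cast h1
  obtain ⟨C, δ, hC, hδ, hmain⟩ :=
    hexp.exists_measureReal_birkhoffSum_le hKφ hone ν hdual hKψ hε
  refine ⟨C, δ, hC, hδ, fun n hn => ?_⟩
  have hbirk : ∀ x : planeJulia f,
      birkhoffSum T (fun y => ψ y) n x = birkhoffSum (planeMap f) ψ n x := by
    have hit : ∀ k (x : planeJulia f), (T^[k] x : ℂ) = (planeMap f)^[k] x := by
      intro k x
      induction k with
      | zero => rfl
      | succ k ih => rw [Function.iterate_succ_apply', Function.iterate_succ_apply', ← ih]
    exact fun x => Finset.sum_congr rfl fun k _ => by rw [← hit]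
  convert hmain n hn using 1
  rw [measureReal_def, measureReal_def, hνapp, hint ψ]
  congr 2
  ext x
  constructor
  · rintro ⟨hx, h⟩
    refine ⟨⟨x, hx⟩, ?_, rfl⟩
    rw [Set.mem_ofPred_eq, hbirk]
    exact h
  · rintro ⟨y, h, rfl⟩
    rw [Set.mem_ofPred_eq, hbirk] at h
    exact ⟨y.2, h⟩
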